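/- Let $k$ be a field, let $r \ge 1$ be an integer, and let $J_{2r} = \begin{pmatrix} 0 & \mathbf{J} \\ -\mathbf{J} & 0 \end{pmatrix}$, where $\mathbf{J}$ is the $r \times r$ matrix with $1$'s on the secondary diagonal and $0$'s elsewhere. Let $C = (c_{\mu\nu})_{1 \le \mu, \nu \le 2r}$ be a square matrix of independent indeterminates over $k$. Then the ring $$ R = k[c_{\mu\nu};\ \mu, \nu = 1, \dots, 2r] \,/\, (C J_{2r} C^t,\ C^t J_{2r} C), $$ the quotient of the polynomial ring by the ideal generated by all entries of the two matrices $C J_{2r} C^t$ and $C^t J_{2r} C$, is reduced. -/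

import Mathlib

open scoped Matrix

/-- The `r × r` matrix with `1`'s on the secondary diagonal and `0`'s elsewhere, that is, with
entries `δ_{r-i+1, j}` (for indices starting at `1`). -/
def antiDiag (r : ℕ) (A : Type*) [CommRing A] : Matrix (Fin r) (Fin r) A :=
  Matrix.of fun i j => if j = i.rev then 1 else 0

/-- The matrix `J_{2r}` of the standard symplectic form, with upper right block `antiDiag r`,
lower left block `-antiDiag r` and zero diagonal blocks. The first copy of `Fin r` is the set of
indices `1, …, r`, and the second copy is the set of indices `r + 1, …, 2r`. -/
def sympJ (r : ℕ) (A : Type*) [CommRing A] : Matrix (Fin r ⊕ Fin r) (Fin r ⊕ Fin r) A :=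
  Matrix.fromBlocks 0 (antiDiag r A) (-antiDiag r A) 0

/-- The ideal generated by all the entries of a matrix. -/
def entryIdeal {m n A : Type*} [CommRing A] (M : Matrix m n A) : Ideal A :=
  Ideal.span (Set.range fun p : m × n => M p.1 p.2)

/-- The square matrix `C = (c_{μν})` of size `2r` whose entries are independent indeterminates
over `k`. -/
noncomputable abbrev genericC (k : Type*) [CommRing k] (r : ℕ) :
    Matrix (Fin r ⊕ Fin r) (Fin r ⊕ Fin r)
      (MvPolynomial ((Fin r ⊕ Fin r) × (Fin r ⊕ Fin r)) k) :=
  Matrix.mvPolynomialX (Fin r ⊕ Fin r) (Fin r ⊕ Fin r) k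

/-- The ideal `(C J Cᵗ, Cᵗ J C)` of `k[c_{μν}]`. -/
noncomputable def sympIdeal (k : Type*) [CommRing k] (r : ℕ) :
    Ideal (MvPolynomial ((Fin r ⊕ Fin r) × (Fin r ⊕ Fin r)) k) :=
  entryIdeal (genericC k r * sympJ r _ * (genericC k r)ᵀ) ⊔
    entryIdeal ((genericC k r)ᵀ * sympJ r _ * genericC k r)

/-- The ring `R = k[c_{μν}] / (C J Cᵗ, Cᵗ J C)`. -/
abbrev SympRing (k : Type*) [CommRing k] (r : ℕ) : Type _ :=
  MvPolynomial ((Fin r ⊕ Fin r) × (Fin r ⊕ Fin r)) k ⧸ sympIdeal k r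

/-! The method is that of principal radical systems: the ideal is placed in a family whose members
are all shown to be radical by one induction. Rows are grouped in hyperbolic pairs (`pairForm`);
columns keep their order, the mirror of column `k` being `k.rev` (`flagForm`). Besides isotropy,
`schubertIdeal k r n j ρ` imposes zeros on the rows of order `< n` and on the first `j` entries of
row `n`, and bounds by `ρ t` the rank of the first `t` columns. Here `ρ` counts a set of columns
without mirror pairs. For `n = j = 0` and `ρ t = min t r` the rank bounds follow from isotropy,
which gives back the original ideal.

The induction is decreasing in `(n, j)` and starts at the zero matrix. At the end of a row the rank
bound `(2 * r - n) / 2` comes for free, because the columns are isotropic in a smaller symplectic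
space; over arbitrary rings this rests on a Pfaffian argument
(`det_submatrix_eq_zero_of_isotropic`). Inside a row, let `x` be the entry `(n, j)`; adding it gives
the next ideal (`schubertIdeal_succ`). If `ρ` jumps at `j`, then `x` is a non-zero-divisor modulo
the radical and `isRadical_of_nonZeroDivisor` concludes. If not, either `ρ (j + 1) = 0` and `x` is
already in the ideal, or some smaller `ρ'` jumps at `j` and `x I(ρ') ⊆ I(ρ) ⊆ I(ρ')`, which suffices
by `isRadical_of_mul_le`.

That `x` is a non-zero-divisor is proved geometrically (`isGoodPoint_of_jump`): from any
field-valued point one moves along lines `C + τ B` inside the variety, possibly several in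
succession over growing function fields, until `x` is nonzero. The choice of `B` depends on whether
column `j` and its mirror are pivots. -/

/-- The standard alternating form on `A²ʳ`, with coordinates indexed by `r` hyperbolic pairs. -/
def pairForm {A : Type*} [CommRing A] {r : ℕ} (u v : Fin r × Bool → A) : A :=
  ∑ m, (u (m, false) * v (m, true) - u (m, true) * v (m, false))

/-- The sign `1` on the first half of the coordinates and `-1` on the second half. -/
def flagSign (A : Type*) [CommRing A] {r : ℕ} (k : Fin (2 * r)) : A :=
  if k.val < r then 1 else -1

/-- The standard alternating form on `A²ʳ` for which the coordinate flag is isotropic. -/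
def flagForm {A : Type*} [CommRing A] {r : ℕ} (u v : Fin (2 * r) → A) : A :=
  ∑ k, flagSign A k * (u k * v k.rev)

/-- The order in which rows are set to zero. -/
def rowOrd {r : ℕ} (i : Fin r × Bool) : ℕ := 2 * i.1.val + i.2.toNat

/-- The expressions that vanish on matrices with isotropic rows and columns, whose first `t`
columns have rank at most `ρ t`, whose rows of order `< n` are zero, and whose row of order `n`
starts with `j` zeros. -/
inductive SchubertGen {A : Type*} [CommRing A] {r : ℕ} (n j : ℕ) (ρ : ℕ → ℕ)
    (C : Matrix (Fin r × Bool) (Fin (2 * r)) A) : A → Prop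
  | row (i i' : Fin r × Bool) : SchubertGen n j ρ C (flagForm (C i) (C i'))
  | col (k l : Fin (2 * r)) : SchubertGen n j ρ C (pairForm (Cᵀ k) (Cᵀ l))
  | minor (t : ℕ) (ht : t ≤ 2 * r) (f : Fin (ρ t + 1) → Fin r × Bool)
      (g : Fin (ρ t + 1) → Fin (2 * r)) (hg : ∀ i, (g i).val < t) :
      SchubertGen n j ρ C (C.submatrix f g).det
  | zero (i : Fin r × Bool) (k : Fin (2 * r))
      (h : rowOrd i < n ∨ rowOrd i = n ∧ k.val < j) : SchubertGen n j ρ C (C i k)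

/-- A matrix satisfying all the conditions of `SchubertGen`. -/
def SchubertSat {A : Type*} [CommRing A] {r : ℕ} (n j : ℕ) (ρ : ℕ → ℕ)
    (C : Matrix (Fin r × Bool) (Fin (2 * r)) A) : Prop :=
  ∀ a, SchubertGen n j ρ C a → a = 0

/-- The generic matrix with rows indexed by hyperbolic pairs. -/
noncomputable abbrev genericM (k : Type*) [CommRing k] (r : ℕ) :
    Matrix (Fin r × Bool) (Fin (2 * r)) (MvPolynomial ((Fin r × Bool) × Fin (2 * r)) k) :=
  Matrix.of fun i l => MvPolynomial.X (i, l)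

/-- The ideal of the conditions `SchubertGen` on a generic matrix. -/
noncomputable def schubertIdeal (k : Type*) [CommRing k] (r n j : ℕ) (ρ : ℕ → ℕ) :
    Ideal (MvPolynomial ((Fin r × Bool) × Fin (2 * r)) k) :=
  Ideal.span {p | SchubertGen n j ρ (genericM k r) p}

/-! ### The two alternating forms. -/

section forms
variable {A B : Type*} [CommRing A] [CommRing B] {r : ℕ}

lemma pairForm_self (u : Fin r × Bool → A) : pairForm u u = 0 :=
  Finset.sum_eq_zero fun m _ => by ring

lemma pairForm_swap (u v : Fin r × Bool → A) : pairForm u v = - pairForm v u := by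
  simp only [pairForm, ← Finset.sum_neg_distrib]
  exact Finset.sum_congr rfl fun m _ => by ring

lemma pairForm_add_left (u u' v : Fin r × Bool → A) :
    pairForm (u + u') v = pairForm u v + pairForm u' v := by
  simp only [pairForm, ← Finset.sum_add_distrib, Pi.add_apply]
  exact Finset.sum_congr rfl fun m _ => by ring

lemma pairForm_smul_left (a : A) (u v : Fin r × Bool → A) :
    pairForm (a • u) v = a * pairForm u v := by
  simp only [pairForm, Finset.mul_sum, Pi.smul_apply, smul_eq_mul]
  exact Finset.sum_congr rfl fun m _ => by ring

lemma pairForm_add_right (u v v' : Fin r × Bool → A) :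
    pairForm u (v + v') = pairForm u v + pairForm u v' := by
  rw [pairForm_swap, pairForm_add_left, pairForm_swap v, pairForm_swap v']; ring

lemma pairForm_smul_right (a : A) (u v : Fin r × Bool → A) :
    pairForm u (a • v) = a * pairForm u v := by
  rw [pairForm_swap, pairForm_smul_left, pairForm_swap v]; ring

lemma map_pairForm (φ : A →+* B) (u v : Fin r × Bool → A) :
    pairForm (fun i => φ (u i)) (fun i => φ (v i)) = φ (pairForm u v) := by
  simp [pairForm, map_sum]

lemma flagSign_rev (k : Fin (2 * r)) : flagSign A k.rev = - flagSign A k := by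
  unfold flagSign
  have := k.isLt
  rw [Fin.val_rev]
  split_ifs <;> first | omega | simp

lemma flagSign_mul_self (k : Fin (2 * r)) : flagSign A k * flagSign A k = 1 := by
  unfold flagSign; split_ifs <;> simp

lemma map_flagSign (φ : A →+* B) (k : Fin (2 * r)) : φ (flagSign A k) = flagSign B k := by
  unfold flagSign; split_ifs <;> simp

lemma rev_ne_self (k : Fin (2 * r)) : k.rev ≠ k := by
  intro h
  have := congrArg Fin.val h
  rw [Fin.val_rev] at this
  have := k.isLt
  omega

lemma flagForm_self (u : Fin (2 * r) → A) : flagForm u u = 0 := by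
  refine Finset.sum_involution (fun k _ => k.rev) ?_ ?_ ?_ ?_
  · intro k _
    rw [flagSign_rev, Fin.rev_rev]; ring
  · intro k _ _; exact rev_ne_self k
  · intro k _; exact Finset.mem_univ _
  · intro k _; exact Fin.rev_rev k

lemma flagForm_swap (u v : Fin (2 * r) → A) : flagForm u v = - flagForm v u := by
  simp only [flagForm, ← Finset.sum_neg_distrib]
  refine Fintype.sum_equiv Fin.revPerm _ _ fun k => ?_
  simp only [Fin.revPerm_apply, flagSign_rev, Fin.rev_rev]; ring

lemma flagForm_add_left (u u' v : Fin (2 * r) → A) :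
    flagForm (u + u') v = flagForm u v + flagForm u' v := by
  simp only [flagForm, ← Finset.sum_add_distrib, Pi.add_apply]
  exact Finset.sum_congr rfl fun m _ => by ring

lemma flagForm_smul_left (a : A) (u v : Fin (2 * r) → A) :
    flagForm (a • u) v = a * flagForm u v := by
  simp only [flagForm, Finset.mul_sum, Pi.smul_apply, smul_eq_mul]
  exact Finset.sum_congr rfl fun m _ => by ring

lemma flagForm_add_right (u v v' : Fin (2 * r) → A) :
    flagForm u (v + v') = flagForm u v + flagForm u v' := by
  rw [flagForm_swap, flagForm_add_left, flagForm_swap v, flagForm_swap v']; ring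

lemma flagForm_smul_right (a : A) (u v : Fin (2 * r) → A) :
    flagForm u (a • v) = a * flagForm u v := by
  rw [flagForm_swap, flagForm_smul_left, flagForm_swap v]; ring

lemma map_flagForm (φ : A →+* B) (u v : Fin (2 * r) → A) :
    flagForm (fun i => φ (u i)) (fun i => φ (v i)) = φ (flagForm u v) := by
  simp [flagForm, map_sum, map_flagSign]

lemma flagForm_single_right (u : Fin (2 * r) → A) (k : Fin (2 * r)) :
    flagForm u (Pi.single k 1) = - (flagSign A k * u k.rev) := by
  rw [flagForm, Finset.sum_eq_single k.rev]
  · simp [flagSign_rev]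
  · intro b _ hb
    rw [Pi.single_eq_of_ne (fun h => hb (by rw [← h, Fin.rev_rev]))]; simp
  · simp

/-- The vector `e` with `flagForm u e = ∑ k, u k * y k`. -/
def flagDual (y : Fin (2 * r) → A) : Fin (2 * r) → A := fun k => - (flagSign A k * y k.rev)

lemma flagForm_flagDual (u y : Fin (2 * r) → A) : flagForm u (flagDual y) = u ⬝ᵥ y := by
  refine Finset.sum_congr rfl fun k _ => ?_
  rw [flagDual, flagSign_rev, Fin.rev_rev]
  linear_combination (u k * y k) * flagSign_mul_self (A := A) k

/-- The vector `β` with `pairForm β c = ∑ i, v i * c i`. -/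
def pairDual (v : Fin r × Bool → A) : Fin r × Bool → A :=
  fun i => if i.2 then - v (i.1, false) else v (i.1, true)

lemma pairForm_pairDual (v c : Fin r × Bool → A) : pairForm (pairDual v) c = v ⬝ᵥ c := by
  rw [pairForm, dotProduct, Fintype.sum_prod_type]
  refine Finset.sum_congr rfl fun m _ => ?_
  simp [pairDual]

end forms

/-! ### The defining conditions over arbitrary rings. -/

section sat
variable {A B : Type*} [CommRing A] [CommRing B] {r n j : ℕ} {ρ : ℕ → ℕ}
  {C : Matrix (Fin r × Bool) (Fin (2 * r)) A}

lemma SchubertGen.map (φ : A →+* B) {a : A} (h : SchubertGen n j ρ C a) :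
    SchubertGen n j ρ (C.map φ) (φ a) := by
  cases h with
  | row i i' => rw [← map_flagForm]; exact .row i i'
  | col k l => rw [← map_pairForm]; exact .col k l
  | minor t ht f g hg =>
    rw [RingHom.map_det]; exact .minor t ht f g hg
  | zero i k h => exact .zero (C := C.map φ) i k h

lemma SchubertGen.exists_of_map (φ : A →+* B) {b : B} (h : SchubertGen n j ρ (C.map φ) b) :
    ∃ a, SchubertGen n j ρ C a ∧ φ a = b := by
  cases h with
  | row i i' => exact ⟨_, .row i i', (map_flagForm φ _ _).symm⟩
  | col k l => exact ⟨_, .col k l, (map_pairForm φ _ _).symm⟩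
  | minor t ht f g hg => exact ⟨_, .minor t ht f g hg, RingHom.map_det φ _⟩
  | zero i k h => exact ⟨_, .zero i k h, rfl⟩

lemma SchubertSat.map (φ : A →+* B) (h : SchubertSat n j ρ C) : SchubertSat n j ρ (C.map φ) := by
  intro b hb
  obtain ⟨a, ha, rfl⟩ := hb.exists_of_map φ
  rw [h a ha, map_zero]

/-- This universal property turns every inclusion of ideals into a check on one matrix over a
quotient ring. -/
lemma schubertIdeal_le_ker_iff {k : Type*} [CommRing k]
    (φ : MvPolynomial ((Fin r × Bool) × Fin (2 * r)) k →+* A) :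
    schubertIdeal k r n j ρ ≤ RingHom.ker φ ↔ SchubertSat n j ρ ((genericM k r).map φ) := by
  rw [schubertIdeal, Ideal.span_le]
  constructor
  · intro h b hb
    obtain ⟨a, ha, rfl⟩ := hb.exists_of_map φ
    exact h ha
  · intro h a ha
    exact h _ (ha.map φ)

lemma schubertSat_quotient (k : Type*) [CommRing k] {I : Ideal _}
    (h : schubertIdeal k r n j ρ ≤ I) :
    SchubertSat n j ρ ((genericM k r).map (Ideal.Quotient.mk I)) := by
  rw [← schubertIdeal_le_ker_iff, Ideal.mk_ker]; exact h

lemma schubertIdeal_le_iff {k : Type*} [CommRing k] {I : Ideal _} :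
    schubertIdeal k r n j ρ ≤ I ↔
      SchubertSat n j ρ ((genericM k r).map (Ideal.Quotient.mk I)) := by
  rw [← schubertIdeal_le_ker_iff, Ideal.mk_ker]

lemma schubertSat_iff : SchubertSat n j ρ C ↔
    (∀ i i', flagForm (C i) (C i') = 0) ∧ (∀ k l, pairForm (Cᵀ k) (Cᵀ l) = 0) ∧
    (∀ t ≤ 2 * r, ∀ (f : Fin (ρ t + 1) → Fin r × Bool) (g : Fin (ρ t + 1) → Fin (2 * r)),
      (∀ i, (g i).val < t) → (C.submatrix f g).det = 0) ∧
    (∀ i k, rowOrd i < n ∨ rowOrd i = n ∧ k.val < j → C i k = 0) := by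
  constructor
  · intro h
    exact ⟨fun i i' => h _ (.row i i'), fun k l => h _ (.col k l),
      fun t ht f g hg => h _ (.minor t ht f g hg), fun i k hk => h _ (.zero i k hk)⟩
  · rintro ⟨h1, h2, h3, h4⟩ a ha
    cases ha with
    | row i i' => exact h1 i i'
    | col k l => exact h2 k l
    | minor t ht f g hg => exact h3 t ht f g hg
    | zero i k h => exact h4 i k h

/-- One more column raises the rank by at most one. In terms of minors: expand along the only column
that may equal `k`; if `k` occurs twice the minor is zero anyway. -/
lemma det_submatrix_eq_zero_of_add_column {m n : Type*} (D : Matrix m n A) (S : n → Prop)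
    (k : n) {l : ℕ}
    (h : ∀ (f : Fin l → m) (g : Fin l → n), (∀ i, S (g i)) → (D.submatrix f g).det = 0)
    (f : Fin (l + 1) → m) (g : Fin (l + 1) → n) (hg : ∀ i, S (g i) ∨ g i = k) :
    (D.submatrix f g).det = 0 := by
  by_cases h2 : ∃ i i', i ≠ i' ∧ g i = k ∧ g i' = k
  · obtain ⟨i, i', hne, hi, hi'⟩ := h2
    exact Matrix.det_zero_of_column_eq hne fun x => by simp [hi, hi']
  · obtain ⟨i, hi⟩ : ∃ i, ∀ i', i' ≠ i → S (g i') := by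
      by_cases h1 : ∃ i, g i = k
      · obtain ⟨i, hi⟩ := h1
        refine ⟨i, fun i' hne => (hg i').resolve_right fun hk => h2 ⟨i', i, hne, hk, hi⟩⟩
      · exact ⟨0, fun i' _ => (hg i').resolve_right fun hk => h1 ⟨i', hk⟩⟩
    rw [Matrix.det_succ_column _ i]
    refine Finset.sum_eq_zero fun x _ => ?_
    rw [Matrix.submatrix_submatrix, h, mul_zero]
    intro y
    exact hi _ (Fin.succAbove_ne i y)

lemma det_submatrix_eq_zero_of_le {m n : Type*} (D : Matrix m n A) (S : n → Prop) {l l' : ℕ}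
    (hl : l ≤ l')
    (h : ∀ (f : Fin l → m) (g : Fin l → n), (∀ i, S (g i)) → (D.submatrix f g).det = 0)
    (f : Fin l' → m) (g : Fin l' → n) (hg : ∀ i, S (g i)) :
    (D.submatrix f g).det = 0 := by
  induction l', hl using Nat.le_induction with
  | base => exact h f g hg
  | succ l' _ ih =>
    exact det_submatrix_eq_zero_of_add_column D S (g 0) ih f g fun i => Or.inl (hg i)

end sat

/-! ### Pfaffians and isotropic vectors over arbitrary rings. -/

section alternating

/-- The determinant of an alternating matrix over a field is a square. -/
theorem isSquare_det_of_alternating {F : Type*} [Field F] (N : ℕ) :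
    ∀ {m : Type} [Fintype m] [DecidableEq m], Fintype.card m = N → ∀ M : Matrix m m F,
      Mᵀ = -M → (∀ i, M i i = 0) → IsSquare M.det := by
  induction N using Nat.strong_induction_on with
  | _ N ih =>
  intro m _ _ hN M hM hd
  by_cases h0 : M = 0
  · rcases isEmpty_or_nonempty m with he | he
    · rw [Matrix.det_isEmpty]; exact IsSquare.one
    · rw [h0, Matrix.det_zero]; exact IsSquare.zero
  obtain ⟨i, j, hij⟩ : ∃ i j, M i j ≠ 0 := by
    by_contra! h
    exact h0 (Matrix.ext h)
  have hne : i ≠ j := fun h => hij (by rw [h]; exact hd j)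
  have hji : M j i = - M i j := congrFun (congrFun hM i) j
  -- The `2 × 2` block on `i, j` has determinant `M i j ^ 2`, and its Schur complement is again
  -- alternating. Zero diagonals are tracked separately so that characteristic 2 is covered.
  let p : m → Prop := fun x => x = i ∨ x = j
  let A := M.toBlock p p
  let B := M.toBlock p (fun x => ¬ p x)
  let B' := M.toBlock (fun x => ¬ p x) p
  let D := M.toBlock (fun x => ¬ p x) (fun x => ¬ p x)
  have hB' : B' = -Bᵀ := by
    ext x y; exact congrFun (congrFun hM y.1) x.1
  have hdet : M.det = (Matrix.fromBlocks A B B' D).det := by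
    rw [← Matrix.det_submatrix_equiv_self (Equiv.sumCompl p) M]
    congr 1
    ext x y
    rcases x with x | x <;> rcases y with y | y <;> rfl
  let e : Fin 2 → {x // p x} := ![⟨i, Or.inl rfl⟩, ⟨j, Or.inr rfl⟩]
  have he : Function.Bijective e := by
    constructor
    · intro x y hxy
      fin_cases x <;> fin_cases y <;> simp [e] at hxy ⊢
      · exact hne hxy
      · exact hne hxy.symm
    · rintro ⟨x, rfl | rfl⟩
      · exact ⟨0, rfl⟩
      · exact ⟨1, rfl⟩
  have hA : A.det = M i j * M i j := by
    rw [← Matrix.det_submatrix_equiv_self (Equiv.ofBijective e he) A, Matrix.det_fin_two]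
    change M i i * M j j - M i j * M j i = _
    rw [hd, hji]; ring
  have hAu : IsUnit A.det := by rw [hA]; exact (mul_ne_zero hij hij).isUnit
  have : Invertible A := Matrix.invertibleOfIsUnitDet A hAu
  have hAt : Aᵀ = -A := by
    ext x y; exact congrFun (congrFun hM x.1) y.1
  have hAit : (⅟A)ᵀ = -⅟A := by
    rw [Matrix.invOf_eq_nonsing_inv, Matrix.transpose_nonsing_inv, hAt]
    refine Matrix.inv_eq_left_inv ?_
    rw [neg_mul_neg, Matrix.nonsing_inv_mul A hAu]
  have hAid : ∀ v : {x // p x} → F, v ⬝ᵥ (⅟A *ᵥ v) = 0 := by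
    intro v
    have hAd : ∀ w : {x // p x} → F, w ⬝ᵥ (A *ᵥ w) = 0 := by
      intro w
      have hf : ∀ g : {x // p x} → F, ∑ x, g x = g (e 0) + g (e 1) := fun g => by
        rw [← (Equiv.ofBijective e he).sum_comp, Fin.sum_univ_two]; rfl
      simp only [dotProduct, Matrix.mulVec, hf]
      change _ * (M i i * _ + M i j * _) + _ * (M j i * _ + M j j * _) = _
      rw [hd, hd, hji]; ring
    have := hAd (⅟A *ᵥ v)
    rw [Matrix.mulVec_mulVec, mul_invOf_self, Matrix.one_mulVec, dotProduct_comm] at this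
    exact this
  rw [hdet, Matrix.det_fromBlocks₁₁, hA]
  refine IsSquare.mul ⟨_, rfl⟩ (ih (Fintype.card {x // ¬ p x}) ?_ rfl _ ?_ ?_)
  · rw [← hN]; exact Fintype.card_subtype_lt (x := i) (fun h => h (Or.inl rfl))
  · have hDt : Dᵀ = -D := by
      ext x y; exact congrFun (congrFun hM x.1) y.1
    rw [Matrix.transpose_sub, hDt, hB', Matrix.transpose_mul, Matrix.transpose_mul, hAit]
    simp
    rw [Matrix.mul_assoc]; abel
  · intro x
    have h1 : (B' * ⅟A * B) x x = 0 := by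
      rw [hB', Matrix.mul_assoc, Matrix.neg_mul, Matrix.neg_apply, neg_eq_zero]
      have := hAid (fun y => B y x)
      rw [← this]
      simp only [Matrix.mul_apply, dotProduct, Matrix.mulVec, Matrix.transpose_apply]
    rw [Matrix.sub_apply, h1, sub_zero]
    exact hd x.1

/-- The determinant of an alternating matrix over an integrally closed domain is a square. -/
theorem exists_sq_eq_det_of_alternating {T : Type*} [CommRing T] [IsDomain T]
    [IsIntegrallyClosed T] {m : Type} [Fintype m] [DecidableEq m] (M : Matrix m m T)
    (hM : Mᵀ = -M) (hd : ∀ i, M i i = 0) : ∃ P, P ^ 2 = M.det := by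
  obtain ⟨y, hy⟩ := isSquare_det_of_alternating (F := FractionRing T) _ rfl
    (M.map (algebraMap T (FractionRing T)))
    (by rw [← Matrix.transpose_map, hM]; ext; simp) (fun i => by simp [hd])
  have hy2 : y ^ 2 = algebraMap T (FractionRing T) M.det := by
    rw [RingHom.map_det, sq]; exact hy.symm
  have : IsIntegral T y := IsIntegral.of_pow (n := 2) two_pos (by
    rw [hy2]; exact isIntegral_algebraMap)
  obtain ⟨P, rfl⟩ := IsIntegrallyClosed.isIntegral_iff.1 this
  exact ⟨P, IsFractionRing.injective T (FractionRing T) (by rw [map_pow, hy2])⟩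

/-- The three shears multiply to the block matrix with rows `(0, -1)` and `(1, 0)`, of determinant
1, so no sign depending on the size has to be computed. -/
theorem det_fromBlocks_neg_transpose_zero {A : Type*} [CommRing A] {m : Type*} [Fintype m]
    [DecidableEq m] (G N : Matrix m m A) :
    (Matrix.fromBlocks G N (-Nᵀ) 0).det = N.det ^ 2 := by
  have h : Matrix.fromBlocks G N (-Nᵀ) 0 * (Matrix.fromBlocks 1 (-1) 0 1 *
      Matrix.fromBlocks 1 0 1 1 * Matrix.fromBlocks 1 (-1) 0 1) =
      Matrix.fromBlocks N (-G) 0 Nᵀ := by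
    simp [Matrix.fromBlocks_multiply]
  have := congrArg Matrix.det h
  simpa [Matrix.det_mul, Matrix.det_fromBlocks_zero₂₁, Matrix.det_fromBlocks_zero₁₂, sq]
    using this

/-- The Gram matrix factors through a free module of rank `2 * a`. -/
theorem det_pairForm_eq_zero {A : Type*} [CommRing A] [IsDomain A] {a : ℕ} {m : Type*} [Fintype m]
    [DecidableEq m] (hm : 2 * a < Fintype.card m) (w : m → Fin a × Bool → A) :
    (Matrix.of fun x y => pairForm (w x) (w y)).det = 0 := by
  by_contra h0
  have h1 := Matrix.rank_of_det_ne_zero h0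
  have h2 : (Matrix.of fun x y => pairForm (w x) (w y)) =
      (Matrix.of fun x (i : Fin a × Bool) => pairForm (w x) (Pi.single i 1)) *
        (Matrix.of fun i y => w y i) := by
    ext x y
    have : w y = ∑ i, w y i • (Pi.single i 1 : Fin a × Bool → A) := by
      ext i; simp [Finset.sum_apply, Pi.single_apply]
    rw [Matrix.of_apply, Matrix.mul_apply]
    conv_lhs => rw [this]
    let φ : (Fin a × Bool → A) →+ A :=
      ⟨⟨pairForm (w x), by simpa using pairForm_smul_right 0 (w x) 0⟩,
        pairForm_add_right (w x)⟩
    change φ _ = _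
    rw [map_sum]
    refine Finset.sum_congr rfl fun i _ => ?_
    change pairForm _ _ = _
    rw [pairForm_smul_right, mul_comm]; rfl
  rw [h2] at h1
  have h3 := Matrix.rank_mul_le_right (Matrix.of fun x (i : Fin a × Bool) =>
    pairForm (w x) (Pi.single i 1)) (Matrix.of fun i y => w y i)
  have h4 := Matrix.rank_le_card_height (Matrix.of fun i y => w y i)
  simp only [Fintype.card_prod, Fintype.card_fin, Fintype.card_bool] at h4
  omega
/-- `a + 1` pairwise orthogonal vectors in the standard symplectic module of rank `2a` have
vanishing maximal minors. -/
theorem det_submatrix_eq_zero_of_isotropic {A : Type*} [CommRing A] {a : ℕ}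
    (V : Matrix (Fin a × Bool) (Fin (a + 1)) A) (hV : ∀ k l, pairForm (Vᵀ k) (Vᵀ l) = 0)
    (f : Fin (a + 1) → Fin a × Bool) : (V.submatrix f id).det = 0 := by
  -- Let `P` be a square root of the determinant of the generic alternating matrix of size `2a + 2`.
  -- When the lower right block is set to zero, `P` becomes `± det N`. On the Gram matrix of `a + 1`
  -- dual coordinate vectors and the `a + 1` columns, `P` vanishes because the rank is at most `2a`.
  -- For isotropic columns both specializations agree, and `N` becomes the minor in question.
  let m := Fin (a + 1) ⊕ Fin (a + 1)
  let T := MvPolynomial (m × m) ℤ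
  let M : Matrix m m T := Matrix.of fun x y => MvPolynomial.X (x, y) - MvPolynomial.X (y, x)
  obtain ⟨P, hP⟩ := exists_sq_eq_det_of_alternating M
    (by ext x y; simp [M]) (fun i => by simp [M])
  let N : Matrix (Fin (a + 1)) (Fin (a + 1)) T := M.toBlocks₁₂
  let θ : T →+* T := (MvPolynomial.aeval fun p : m × m =>
    if p.1.isRight && p.2.isRight then (0 : T) else MvPolynomial.X p).toRingHom
  have hθX : ∀ x y, θ (MvPolynomial.X (x, y)) =
      if x.isRight && y.isRight then (0 : T) else MvPolynomial.X (x, y) := fun x y =>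
    MvPolynomial.aeval_X _ _
  have hθM : M.map θ = Matrix.fromBlocks M.toBlocks₁₁ N (-Nᵀ) 0 := by
    ext x y
    rcases x with x | x <;> rcases y with y | y <;>
      simp [M, N, hθX, Matrix.toBlocks₁₁, Matrix.toBlocks₁₂]
  have hsq : θ P ^ 2 = N.det ^ 2 := by
    rw [← map_pow, hP, RingHom.map_det, RingHom.mapMatrix_apply, hθM,
      det_fromBlocks_neg_transpose_zero]
  -- the universal Gram matrix
  let A₀ := MvPolynomial ((Fin a × Bool) × Fin (a + 1)) ℤ
  let V₀ : Matrix (Fin a × Bool) (Fin (a + 1)) A₀ := Matrix.of fun i k => MvPolynomial.X (i, k)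
  let w : m → Fin a × Bool → A₀ :=
    Sum.elim (fun i => pairDual (Pi.single (f i) 1)) V₀ᵀ
  let num : m → ℕ := Sum.elim (fun i => i.val) (fun i => a + 1 + i.val)
  have hnum : Function.Injective num := by
    rintro (x | x) (y | y) h <;> simp only [num, Sum.elim_inl, Sum.elim_inr] at h
    · rw [Fin.ext h]
    · omega
    · omega
    · rw [Fin.ext (by omega : x.val = y.val)]
  -- Only the variables above the diagonal for the order `num` are used, so that `X (x, y) - X (y,
  -- x)` maps exactly to the Gram entry.
  let ψ : T →+* A₀ := (MvPolynomial.aeval fun p : m × m =>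
    if num p.1 < num p.2 then pairForm (w p.1) (w p.2) else 0).toRingHom
  have hψX : ∀ x y, ψ (MvPolynomial.X (x, y)) =
      if num x < num y then pairForm (w x) (w y) else 0 := fun x y =>
    MvPolynomial.aeval_X _ _
  have hψM : M.map ψ = Matrix.of fun x y => pairForm (w x) (w y) := by
    ext1 x y
    simp only [M, Matrix.map_apply, Matrix.of_apply, map_sub, hψX]
    rcases lt_trichotomy (num x) (num y) with h | h | h
    · rw [if_pos h, if_neg h.le.not_gt, sub_zero]
    · rw [hnum h]; simp [pairForm_self]
    · rw [if_neg h.le.not_gt, if_pos h, zero_sub, ← pairForm_swap]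
  have hψP : ψ P = 0 := by
    refine pow_eq_zero_iff (two_ne_zero) |>.1 ?_
    rw [← map_pow, hP, RingHom.map_det, RingHom.mapMatrix_apply, hψM]
    refine det_pairForm_eq_zero ?_ w
    simp only [m, Fintype.card_sum, Fintype.card_fin]; omega
  let χ : A₀ →+* A := (MvPolynomial.aeval fun p : (Fin a × Bool) × Fin (a + 1) =>
    V p.1 p.2).toRingHom
  have hχX : ∀ i k, χ (V₀ i k) = V i k := fun i k => MvPolynomial.aeval_X _ _
  -- This is where isotropy enters: the pairings of two columns of `V₀` die under `χ`.
  have hcomp : (χ.comp ψ).comp θ = χ.comp ψ := by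
    refine MvPolynomial.ringHom_ext (fun c => by simp) fun ⟨x, y⟩ => ?_
    rw [RingHom.comp_apply, hθX]
    split_ifs with hxy
    · rcases x with x | x
      · simp at hxy
      rcases y with y | y
      · simp at hxy
      rw [map_zero, RingHom.comp_apply, hψX]
      split_ifs
      · rw [← map_pairForm]
        have hw : ∀ k, (fun i => χ (w (Sum.inr k) i)) = Vᵀ k := fun k => funext fun i => hχX i k
        rw [hw, hw, hV]
      · rw [map_zero]
    · rfl
  have hN : χ.comp ψ N.det = (V.submatrix f id).det := by
    rw [RingHom.map_det]
    congr 1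
    ext i k
    change χ (ψ (M (Sum.inl i) (Sum.inr k))) = _
    have : ψ (M (Sum.inl i) (Sum.inr k)) = V₀ (f i) k := by
      have := congrFun (congrFun hψM (Sum.inl i)) (Sum.inr k)
      rw [Matrix.map_apply] at this
      rw [this]
      change pairForm (pairDual (Pi.single (f i) 1)) (V₀ᵀ k) = _
      rw [pairForm_pairDual, single_one_dotProduct]; rfl
    rw [this, hχX]; rfl
  have h0 : χ.comp ψ (θ P) = 0 := by
    rw [← RingHom.comp_apply, hcomp, RingHom.comp_apply, hψP, map_zero]
  rcases sq_eq_sq_iff_eq_or_eq_neg.1 hsq with h | h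
  · rw [← hN, ← h, h0]
  · rw [← hN, ← neg_eq_zero, ← map_neg, ← h, h0]

end alternating

/-! ### Consequences of the equations along a row. -/

section sat_step
variable {A : Type*} [CommRing A]

/-- With the first `m` hyperbolic pairs of rows zero, the columns are isotropic vectors in the
symplectic module on the other `a` pairs. -/
lemma det_submatrix_eq_zero_of_zero_rows {m a c : ℕ}
    (C : Matrix (Fin (m + a) × Bool) (Fin c) A)
    (h0 : ∀ i k, rowOrd i < 2 * m → C i k = 0) (hC : ∀ k l, pairForm (Cᵀ k) (Cᵀ l) = 0)
    (f : Fin (a + 1) → Fin (m + a) × Bool) (g : Fin (a + 1) → Fin c) :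
    (C.submatrix f g).det = 0 := by
  by_cases hf : ∃ i, rowOrd (f i) < 2 * m
  · obtain ⟨i, hi⟩ := hf
    exact Matrix.det_eq_zero_of_row_eq_zero i fun k => h0 _ _ hi
  push Not at hf
  have hf' : ∀ i, m ≤ (f i).1.val := by
    intro i
    have := hf i
    have hb : (f i).2.toNat ≤ 1 := Bool.toNat_le _
    unfold rowOrd at this
    omega
  let f' : Fin (a + 1) → Fin a × Bool := fun i =>
    (⟨(f i).1.val - m, by have := (f i).1.isLt; have := hf' i; omega⟩, (f i).2)
  let V : Matrix (Fin a × Bool) (Fin (a + 1)) A :=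
    Matrix.of fun x k => C (Fin.natAdd m x.1, x.2) (g k)
  have hV : ∀ k l, pairForm (Vᵀ k) (Vᵀ l) = 0 := by
    intro k l
    have := hC (g k) (g l)
    rw [pairForm, Fin.sum_univ_add, Finset.sum_eq_zero, zero_add] at this
    · exact this
    · intro x _
      have h1 : ∀ b, C (Fin.castAdd a x, b) (g k) = 0 := fun b => h0 _ _ (by
        have hb : b.toNat ≤ 1 := Bool.toNat_le _
        have := x.isLt
        simp only [rowOrd, Fin.val_castAdd]; omega)
      simp [h1]
  rw [← det_submatrix_eq_zero_of_isotropic V hV f']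
  congr 1
  ext i k
  simp only [Matrix.submatrix_apply, V, f', Matrix.of_apply, id]
  congr 2
  ext
  · simp only [Fin.val_natAdd]; have := hf' i; omega
  · rfl

variable {r n j : ℕ} {ρ : ℕ → ℕ} {C : Matrix (Fin r × Bool) (Fin (2 * r)) A}

lemma schubertSat_next_row_iff (hn : n < 2 * r) (hρ : ∀ t ≤ 2 * r, ρ t ≤ (2 * r - n + 1) / 2) :
    SchubertSat n (2 * r) ρ C ↔ SchubertSat (n + 1) 0 (fun t => min (ρ t) ((2 * r - n) / 2)) C := by
  have hz : (∀ (i : Fin r × Bool) (k : Fin (2 * r)),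
        rowOrd i < n ∨ rowOrd i = n ∧ k.val < 2 * r → C i k = 0) ↔
      (∀ (i : Fin r × Bool) (k : Fin (2 * r)),
        rowOrd i < n + 1 ∨ rowOrd i = n + 1 ∧ k.val < 0 → C i k = 0) := by
    refine forall_congr' fun i => forall_congr' fun k => ?_
    have := k.isLt
    have : (rowOrd i < n ∨ rowOrd i = n ∧ k.val < 2 * r) ↔
      (rowOrd i < n + 1 ∨ rowOrd i = n + 1 ∧ k.val < 0) := by omega
    rw [this]
  rw [schubertSat_iff, schubertSat_iff, hz]
  constructor
  · rintro ⟨h1, h2, h3, h4⟩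
    refine ⟨h1, h2, fun t ht f g hg => ?_, h4⟩
    rcases le_or_gt (ρ t) ((2 * r - n) / 2) with h | h
    · exact det_submatrix_eq_zero_of_le C (fun k => k.val < t) (by rw [min_eq_left h])
        (h3 t ht) f g hg
    · have hρt := hρ t ht
      obtain ⟨a, ha⟩ : ∃ a, a = (2 * r - n) / 2 := ⟨_, rfl⟩
      obtain ⟨m, rfl⟩ : ∃ m, r = m + a := ⟨r - a, by omega⟩
      refine det_submatrix_eq_zero_of_le C (fun _ => True) (l := a + 1) ?_ ?_ f g
        (fun _ => trivial)
      · omega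
      · intro f g _
        exact det_submatrix_eq_zero_of_zero_rows C
          (fun i k hi => h4 i k (Or.inl (by omega))) h2 f g
  · rintro ⟨h1, h2, h3, h4⟩
    refine ⟨h1, h2, fun t ht f g hg => ?_, h4⟩
    exact det_submatrix_eq_zero_of_le C (fun k => k.val < t)
      (by have := min_le_left (ρ t) ((2 * r - n) / 2); omega) (h3 t ht) f g hg

/-- The product is the minor bordered by row `i₀` and column `j`: row `i₀` vanishes in the columns
before `j`. The bordered minor has size `ρ (j + 1) + 1`. -/
lemma SchubertSat.mul_det_eq_zero_of_le (hC : SchubertSat n j ρ C) {i₀ : Fin r × Bool}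
    (hi₀ : rowOrd i₀ = n) (hj : j < 2 * r) {t l : ℕ} (ht : t ≤ j) (hl : ρ (j + 1) = l)
    (f : Fin l → Fin r × Bool) (g : Fin l → Fin (2 * r)) (hg : ∀ i, (g i).val < t) :
    C i₀ ⟨j, hj⟩ * (C.submatrix f g).det = 0 := by
  subst hl
  obtain ⟨-, -, h3, h4⟩ := schubertSat_iff.1 hC
  have := h3 (j + 1) (by omega) (Fin.cons i₀ f) (Fin.cons ⟨j, hj⟩ g) (fun i => by
    refine Fin.cases ?_ (fun i => ?_) i
    · simp
    · rw [Fin.cons_succ]; have := hg i; omega)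
  rw [Matrix.det_succ_row_zero, Fin.sum_univ_succ, Finset.sum_eq_zero, add_zero] at this
  · simpa [Matrix.submatrix_submatrix, Function.comp_def] using this
  · intro i _
    have : C i₀ (g i) = 0 := h4 _ _ (Or.inr ⟨hi₀, by have := hg i; omega⟩)
    simp [this]

/-- Orthogonality of row `i₀` to the other rows is a linear relation among the columns; as row `i₀`
starts with `j` zeros, the last column involved is the mirror of `j`. -/
lemma SchubertSat.exists_mul_col_eq (hC : SchubertSat n j ρ C) {i₀ : Fin r × Bool}
    (hi₀ : rowOrd i₀ = n) (hj : j < 2 * r) : ∃ d : Fin (2 * r) → A,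
      (∀ k, ¬ k < (⟨j, hj⟩ : Fin (2 * r)).rev → d k = 0) ∧
      ∀ i, C i₀ ⟨j, hj⟩ * C i (⟨j, hj⟩ : Fin (2 * r)).rev = ∑ k, d k * C i k := by
  obtain ⟨h1, -, -, h4⟩ := schubertSat_iff.1 hC
  set x : Fin (2 * r) := ⟨j, hj⟩ with hx
  refine ⟨fun k => if k < x.rev then flagSign A x * (flagSign A k * C i₀ k.rev) else 0,
    fun k hk => if_neg hk, fun i => ?_⟩
  have h := h1 i₀ i
  rw [flagForm_swap, neg_eq_zero, flagForm, ← Finset.sum_erase_add _ _ (Finset.mem_univ x.rev),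
    Fin.rev_rev] at h
  dsimp only
  rw [← Finset.sum_erase_add _ _ (Finset.mem_univ x.rev), if_neg (lt_irrefl _), zero_mul, add_zero]
  have h2 : ∑ k ∈ Finset.univ.erase x.rev,
      (if k < x.rev then flagSign A x * (flagSign A k * C i₀ k.rev) else 0) * C i k =
      flagSign A x * ∑ k ∈ Finset.univ.erase x.rev, flagSign A k * (C i k * C i₀ k.rev) := by
    rw [Finset.mul_sum]
    refine Finset.sum_congr rfl fun k hk => ?_
    split_ifs with hlt
    · ring
    · have hne := (Finset.mem_erase.1 hk).1
      have hgt : x.rev < k := lt_of_le_of_ne (not_lt.1 hlt) hne.symm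
      have : C i₀ k.rev = 0 := h4 _ _ (Or.inr ⟨hi₀, by
        have : k.rev < x := by rw [← Fin.rev_lt_rev, Fin.rev_rev]; exact hgt
        exact this⟩)
      rw [this]; ring
  rw [h2, eq_neg_of_add_eq_zero_left h, flagSign_rev]
  linear_combination -(C i₀ x * C i x.rev) * flagSign_mul_self (A := A) x

lemma SchubertSat.mul_det_eq_zero_of_gt (hC : SchubertSat n j ρ C) {i₀ : Fin r × Bool}
    (hi₀ : rowOrd i₀ = n) (hj : j < 2 * r) {t l : ℕ} (ht : 2 * r - 1 - j < t) (ht' : t ≤ 2 * r)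
    (hρ : ∀ s, 2 * r - 1 - j ≤ s → s < t → ρ (s + 1) = ρ s + 1) (hl : ρ t = l)
    (f : Fin l → Fin r × Bool) (g : Fin l → Fin (2 * r)) (hg : ∀ i, (g i).val < t) :
    C i₀ ⟨j, hj⟩ * (C.submatrix f g).det = 0 := by
  obtain ⟨-, -, h3, h4⟩ := schubertSat_iff.1 hC
  set x : Fin (2 * r) := ⟨j, hj⟩ with hx
  have hxr : x.rev.val = 2 * r - 1 - j := by rw [Fin.val_rev]; simp only [hx]; omega
  -- Without the mirror column, the first `s` columns have one column less than the run of jumps of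
  -- `ρ` allows, so the rank drops below `ρ s`. The general minor reduces to this by replacing the
  -- mirror column with earlier ones.
  have key : ∀ s, 2 * r - 1 - j < s → s ≤ t → ∀ (f : Fin (ρ s) → Fin r × Bool)
      (g : Fin (ρ s) → Fin (2 * r)), (∀ i, (g i).val < s ∧ g i ≠ x.rev) →
      (C.submatrix f g).det = 0 := by
    intro s hs
    induction s, Nat.succ_le_of_lt hs using Nat.le_induction with
    | base =>
      intro hst f g hg
      refine det_submatrix_eq_zero_of_le C (fun k => k.val < 2 * r - 1 - j)
        (hρ _ le_rfl ht).ge (h3 _ (by omega)) f g fun i => ?_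
      obtain ⟨h1, h2⟩ := hg i
      have : (g i).val ≠ 2 * r - 1 - j := fun h => h2 (Fin.ext (by rw [hxr]; exact h))
      omega
    | succ s hs' ih =>
      intro hst f g hg
      refine det_submatrix_eq_zero_of_le C (fun k => k.val < s + 1 ∧ k ≠ x.rev) (l := ρ s + 1)
        (hρ _ (by omega) (by omega)).ge ?_ f g hg
      intro f g hg
      refine det_submatrix_eq_zero_of_add_column C (fun k => k.val < s ∧ k ≠ x.rev)
        ⟨s, by omega⟩ (ih (by omega) (by omega)) f g fun i => ?_
      obtain ⟨h1, h2⟩ := hg i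
      by_cases h : (g i).val = s
      · exact Or.inr (Fin.ext h)
      · exact Or.inl ⟨by omega, h2⟩
  subst hl
  have key := key t ht le_rfl
  by_cases hex : ∃ i, g i = x.rev
  swap
  · rw [key f g fun i => ⟨hg i, fun h => hex ⟨i, h⟩⟩, mul_zero]
  obtain ⟨i, hi⟩ := hex
  by_cases h2 : ∃ i', i' ≠ i ∧ g i' = x.rev
  · obtain ⟨i', hne, hi'⟩ := h2
    rw [Matrix.det_zero_of_column_eq hne fun y => by simp [hi, hi'], mul_zero]
  obtain ⟨d, hd, hd'⟩ := hC.exists_mul_col_eq hi₀ hj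
  have hcol : C.submatrix f g = (C.submatrix f g).updateCol i (fun y => C (f y) x.rev) := by
    ext y z
    by_cases hz : z = i
    · subst hz; simp [hi]
    · simp [hz]
  rw [hcol, ← Matrix.det_updateCol_smul]
  have hsum : (C i₀ x • fun y => C (f y) x.rev) = ∑ k, d k • fun y => C (f y) k := by
    ext y
    simp [hd', Finset.sum_apply, hx]
  rw [hsum, ← Matrix.cramer_apply, map_sum, Finset.sum_apply]
  refine Finset.sum_eq_zero fun k _ => ?_
  by_cases hk : k < x.rev
  swap
  · rw [hd k hk, zero_smul, map_zero, Pi.zero_apply]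
  rw [map_smul, Pi.smul_apply, Matrix.cramer_apply]
  have : (C.submatrix f g).updateCol i (fun y => C (f y) k) =
      C.submatrix f (Function.update g i k) := by
    ext y z
    by_cases hz : z = i
    · subst hz; simp
    · simp [hz]
  rw [this, key, smul_zero]
  intro z
  by_cases hz : z = i
  · subst hz
    rw [Function.update_self]
    exact ⟨by have : k.val < x.rev.val := hk
              omega, hk.ne⟩
  · rw [Function.update_of_ne hz]
    exact ⟨hg z, fun h => h2 ⟨z, hz, h⟩⟩

end sat_step

/-! ### Combinatorics of rank functions. -/

/-- The rank functions `t ↦ #{k ∈ P | k < t}` of sets `P` of column indices that contain no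
index together with its mirror image. -/
structure IsAdmissible (r : ℕ) (ρ : ℕ → ℕ) : Prop where
  zero : ρ 0 = 0
  step : ∀ t < 2 * r, ρ (t + 1) = ρ t ∨ ρ (t + 1) = ρ t + 1
  pair : ∀ k < 2 * r, ρ (k + 1) = ρ k ∨ ρ (2 * r - 1 - k + 1) = ρ (2 * r - 1 - k)

lemma IsAdmissible.le_of_le {r : ℕ} {ρ : ℕ → ℕ} (h : IsAdmissible r ρ) {s t : ℕ} (hst : s ≤ t)
    (ht : t ≤ 2 * r) : ρ s ≤ ρ t := by
  induction t, hst using Nat.le_induction with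
  | base => exact le_rfl
  | succ t _ ih =>
    have := ih (by omega)
    have := h.step t (by omega)
    omega

lemma IsAdmissible.min {r : ℕ} {ρ : ℕ → ℕ} (h : IsAdmissible r ρ) (b : ℕ) :
    IsAdmissible r (fun t => min (ρ t) b) where
  zero := by simp [h.zero]
  step t ht := by have := h.step t ht; omega
  pair k hk := by
    have := h.pair k hk
    omega

/-- Moving the index `p` of a set to the larger index `j`, in terms of rank functions. -/
lemma exists_rank_move {N : ℕ} {ρ : ℕ → ℕ} (h0 : ρ 0 = 0)
    (hs : ∀ t < N, ρ (t + 1) = ρ t ∨ ρ (t + 1) = ρ t + 1) {p j : ℕ} (hpj : p < j) (hj : j < N)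
    (hp : ρ (p + 1) ≠ ρ p) (hjn : ρ (j + 1) = ρ j) :
    ∃ ρ' : ℕ → ℕ, ρ' 0 = 0 ∧ (∀ t < N, ρ' (t + 1) = ρ' t ∨ ρ' (t + 1) = ρ' t + 1) ∧
      (∀ k < N, ρ' (k + 1) ≠ ρ' k ↔ k = j ∨ ρ (k + 1) ≠ ρ k ∧ k ≠ p) ∧
      ∀ t ≤ N, (p < t ∧ t ≤ j → ρ' t + 1 = ρ t) ∧ (¬ (p < t ∧ t ≤ j) → ρ' t = ρ t) := by
  have hpos : ∀ t, p < t → t ≤ N → 0 < ρ t := by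
    intro t ht
    induction t, Nat.succ_le_of_lt ht using Nat.le_induction with
    | base => intro _; have := hs p (by omega); change 0 < ρ (p + 1); omega
    | succ t _ ih => intro _; have := ih (by omega) (by omega); have := hs t (by omega); omega
  obtain ⟨ρ', h1, h2⟩ : ∃ ρ' : ℕ → ℕ, (∀ t ≤ N, p < t → t ≤ j → ρ' t + 1 = ρ t) ∧
      ∀ t ≤ N, ¬ (p < t ∧ t ≤ j) → ρ' t = ρ t := by
    refine ⟨fun t => if p < t ∧ t ≤ j then ρ t - 1 else ρ t, fun t h1 h2 h3 => ?_,
      fun t _ h2 => if_neg h2⟩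
    have := hpos t h2 h1
    dsimp only
    rw [if_pos ⟨h2, h3⟩]; omega
  have key : ∀ k < N, (k = p ∧ ρ' (k + 1) = ρ' k ∧ ρ (k + 1) = ρ k + 1) ∨
      (k = j ∧ ρ' (k + 1) = ρ' k + 1 ∧ ρ (k + 1) = ρ k) ∨
      (k ≠ p ∧ k ≠ j ∧ ρ' (k + 1) + ρ k = ρ (k + 1) + ρ' k) := by
    intro k hk
    rcases lt_trichotomy k p with h | rfl | h
    · have a1 := h2 k hk.le (by omega)
      have a2 := h2 (k + 1) hk (by omega)
      omega
    · have a1 := h2 k hk.le (by omega)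
      have a2 := h1 (k + 1) hk (by omega) (by omega)
      have := hs k hk
      omega
    rcases lt_trichotomy k j with h' | rfl | h'
    · have a1 := h1 k hk.le h (by omega)
      have a2 := h1 (k + 1) hk (by omega) (by omega)
      omega
    · have a1 := h1 k hk.le h (by omega)
      have a2 := h2 (k + 1) hk (by omega)
      omega
    · have a1 := h2 k hk.le (by omega)
      have a2 := h2 (k + 1) hk (by omega)
      omega
  refine ⟨ρ', by rw [h2 0 (by omega) (by omega), h0], fun t ht => ?_, fun k hk => ?_,
    fun t ht => ⟨fun h => h1 t ht h.1 h.2, h2 t ht⟩⟩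
  · have := key t ht; have := hs t ht; omega
  · have := key k hk; have := hs k hk; omega

lemma IsAdmissible.exists_last_jump {r : ℕ} {ρ : ℕ → ℕ} (h : IsAdmissible r ρ) {l : ℕ}
    (hlr : l < 2 * r) (hl : 0 < ρ (l + 1)) : ∃ p, p ≤ l ∧ ρ (p + 1) = ρ p + 1 ∧
      ∀ t, p < t → t ≤ l + 1 → ρ t = ρ (l + 1) := by
  induction l with
  | zero =>
    
    refine ⟨0, le_rfl, ?_, fun t h1 h2 => by rw [(by omega : t = 0 + 1)]⟩
    have := h.step 0 (by omega)
    have := h.zero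
    omega
  | succ l ih =>
    rcases h.step (l + 1) (by omega) with h1 | h1
    · obtain ⟨p, hp1, hp2, hp3⟩ := ih (by omega) (by omega)
      refine ⟨p, by omega, hp2, fun t ht1 ht2 => ?_⟩
      rcases Nat.lt_or_ge t (l + 2) with h2 | h2
      · rw [hp3 t ht1 (by omega), h1]
      · rw [(by omega : t = l + 1 + 1)]
    · exact ⟨l + 1, le_rfl, h1, fun t h1 h2 => by rw [(by omega : t = l + 1 + 1)]⟩

-- Move the largest element `p < j` of the set to `j`. If the mirror `m` of `j` is in the set, push
-- it up to the first free index `q`. The two alternatives for `ρ' t + 1 = ρ t` are the hypotheses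
-- of `SchubertSat.mul_det_eq_zero_of_le` and `SchubertSat.mul_det_eq_zero_of_gt`.
set_option maxHeartbeats 400000 in
lemma IsAdmissible.exists_insert {r : ℕ} {ρ : ℕ → ℕ} (h : IsAdmissible r ρ) {j : ℕ}
    (hj : j < 2 * r) (hjump : ρ (j + 1) = ρ j) (hpos : 0 < ρ (j + 1)) :
    ∃ ρ', IsAdmissible r ρ' ∧ ρ' (j + 1) = ρ' j + 1 ∧
      ∀ t ≤ 2 * r, ρ' t = ρ t ∨ (ρ' t + 1 = ρ t ∧ ((t ≤ j ∧ ρ t = ρ (j + 1)) ∨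
        (2 * r - 1 - j < t ∧ ∀ s, 2 * r - 1 - j ≤ s → s < t → ρ (s + 1) = ρ s + 1))) := by
  obtain ⟨p, hpj, hp, hpmax⟩ : ∃ p, p < j ∧ ρ (p + 1) = ρ p + 1 ∧
      ∀ t, p < t → t ≤ j + 1 → ρ t = ρ (j + 1) := by
    obtain ⟨p, h1, h2, h3⟩ := h.exists_last_jump hj hpos
    refine ⟨p, lt_of_le_of_ne h1 ?_, h2, h3⟩
    rintro rfl
    omega
  have hpair_p := h.pair p (by omega)
  obtain ⟨m, hm⟩ : ∃ m, m = 2 * r - 1 - j := ⟨_, rfl⟩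
  rw [← hm]
  have hpbar : ρ (2 * r - 1 - p + 1) = ρ (2 * r - 1 - p) :=
    hpair_p.resolve_left (by omega)
  clear hpair_p
  obtain ⟨ρ₁, h10, h1s, h1j, h1v⟩ := exists_rank_move h.zero h.step hpj hj (by omega) hjump
  have hval : ∀ t, p < t → t ≤ j → ρ₁ t + 1 = ρ t ∧ t ≤ j ∧ ρ t = ρ (j + 1) :=
    fun t h2 h3 => ⟨(h1v t (by omega)).1 ⟨h2, h3⟩, h3, hpmax t h2 (by omega)⟩
  by_cases hcase : ρ₁ (m + 1) = ρ₁ m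
  · refine ⟨ρ₁, ⟨h10, h1s, fun k hk => ?_⟩, ?_, fun t ht => ?_⟩
    · have hk' : 2 * r - 1 - k < 2 * r := by omega
      by_contra hcon
      obtain ⟨hc1, hc2⟩ := not_or.1 hcon
      rcases (h1j k hk).1 hc1 with rfl | ⟨h2, h3⟩
      · exact hc2 (by rw [← hm]; exact hcase)
      rcases (h1j _ hk').1 hc2 with h4 | ⟨h4, h5⟩
      · exact hc1 (by rw [(by omega : k = m)]; exact hcase)
      · exact (not_or.2 ⟨h2, h4⟩) (h.pair k hk)
    · have h2 := (h1j j hj).2 (Or.inl rfl)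
      exact (h1s j hj).resolve_left h2
    · by_cases h2 : p < t ∧ t ≤ j
      · obtain ⟨h3, h4⟩ := hval t h2.1 h2.2
        exact Or.inr ⟨h3, Or.inl h4⟩
      · exact Or.inl ((h1v t ht).2 h2)
  · have hmN : m < 2 * r := by omega
    have hmj : ρ (m + 1) ≠ ρ m ∧ m ≠ p := ((h1j m hmN).1 hcase).resolve_left (by omega)
    -- A free index exists above `m`: the mirror of `p` is free since `p` was in the set.
    have hex : ∃ q, m < q ∧ ρ₁ (q + 1) = ρ₁ q := ⟨2 * r - 1 - p, by omega, by
      by_contra hne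
      rcases (h1j _ (by omega)).1 hne with h2 | h2
      · omega
      · exact h2.1 hpbar⟩
    classical
    obtain ⟨q, ⟨hmq, hq⟩, hqmin⟩ : ∃ q, (m < q ∧ ρ₁ (q + 1) = ρ₁ q) ∧
        ∀ s, s < q → ¬ (m < s ∧ ρ₁ (s + 1) = ρ₁ s) :=
      ⟨Nat.find hex, Nat.find_spec hex, fun s hs => Nat.find_min hex hs⟩
    have hqp : q ≤ 2 * r - 1 - p := by
      by_contra hlt
      refine hqmin (2 * r - 1 - p) (by omega) ⟨by omega, ?_⟩
      by_contra hne
      rcases (h1j _ (by omega)).1 hne with h2 | h2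
      · omega
      · exact h2.1 hpbar
    have hqN : q < 2 * r := by omega
    have hqj : q ≠ j := by rintro rfl; exact (h1j q hqN).2 (Or.inl rfl) hq
    have hrun₁ : ∀ s, m ≤ s → s < q → ρ₁ (s + 1) ≠ ρ₁ s := by
      intro s hs1 hs2 hs3
      rcases eq_or_ne s m with rfl | hne
      · exact hcase hs3
      · exact hqmin s hs2 ⟨by omega, hs3⟩
    -- This makes the ranges `p < t ≤ j` and `m < t ≤ q` disjoint, so `ρ` drops by at most one.
    have hqp' : m < j → q ≤ p := by
      intro h2
      by_contra h3
      rcases lt_or_ge m p with h4 | h4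
      · exact hqmin p (by omega) ⟨h4, by
          by_contra h5
          rcases (h1j p (by omega)).1 h5 with h6 | h6
          · omega
          · exact h6.2 rfl⟩
      · exact hmj.1 ((hpmax (m + 1) (by omega) (by omega)).trans
          (hpmax m (by omega) (by omega)).symm)
    have hrun : ∀ s, m ≤ s → s < q → ρ (s + 1) = ρ s + 1 := by
      intro s hs1 hs2
      rcases (h1j s (by omega)).1 (hrun₁ s hs1 hs2) with rfl | h2
      · rcases hs1.lt_or_eq with h3 | h3
        · have := hqp' h3; omega
        · omega
      · exact (h.step s (by omega)).resolve_left h2.1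
    obtain ⟨ρ₂, h20, h2s, h2j, h2v⟩ := exists_rank_move h10 h1s hmq hqN hcase hq
    refine ⟨ρ₂, ⟨h20, h2s, fun k hk => ?_⟩, ?_, fun t ht => ?_⟩
    · have hk' : 2 * r - 1 - k < 2 * r := by omega
      -- As `m < q ≤ 2 * r - 1 - p`, the mirror of `q` lies in `[p, j)`, where `p` was the only
      -- element of the set.
      have hq' : ∀ k < 2 * r, k = q → ρ (2 * r - 1 - k + 1) ≠ ρ (2 * r - 1 - k) →
          2 * r - 1 - k = p := by
        rintro k hk rfl h1
        by_contra h2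
        exact h1 ((hpmax (2 * r - 1 - k + 1) (by omega) (by omega)).trans
          (hpmax (2 * r - 1 - k) (by omega) (by omega)).symm)
      have hkk : 2 * r - 1 - (2 * r - 1 - k) = k := by omega
      have hkj : k = j → 2 * r - 1 - k = m := by rintro rfl; exact hm.symm
      have hkj' : 2 * r - 1 - k = j → k = m := by intro h3; rw [hm, ← h3, hkk]
      have hkq : k = q → 2 * r - 1 - k ≠ q ∧ 2 * r - 1 - k ≠ j := by clear * - hm hmq hk; omega
      by_contra hcon
      obtain ⟨hc1, hc2⟩ := not_or.1 hcon
      rcases (h2j k hk).1 hc1 with h3 | ⟨h3, h3'⟩ <;>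
        rcases (h2j _ hk').1 hc2 with h4 | ⟨h4, h4'⟩
      · exact (hkq h3).1 h4
      · rcases (h1j _ hk').1 h4 with h5 | ⟨h5, h5'⟩
        · exact (hkq h3).2 h5
        · exact h5' (hq' k hk h3 h5)
      · rcases (h1j k hk).1 h3 with h5 | ⟨h5, h5'⟩
        · exact hmq.ne ((hkj h5).symm.trans h4)
        · have := hq' _ hk' h4 (by rwa [hkk])
          exact h5' (by rwa [hkk] at this)
      · rcases (h1j k hk).1 h3 with h5 | ⟨h5, h5'⟩
        · exact h4' (hkj h5)
        · rcases (h1j _ hk').1 h4 with h6 | ⟨h6, h6'⟩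
          · exact h3' (hkj' h6)
          · exact (not_or.2 ⟨h5, h6⟩) (h.pair k hk)
    · have h3 := (h2j j hj).2 (Or.inr ⟨(h1j j hj).2 (Or.inl rfl), by omega⟩)
      exact (h2s j hj).resolve_left h3
    · by_cases h3 : m < t ∧ t ≤ q
      · have h4 := (h2v t ht).1 h3
        have h5 := (h1v t ht).2 (fun h6 => by
          rcases lt_or_ge m j with h7 | h7
          · have := hqp' h7; omega
          · omega)
        exact Or.inr ⟨by omega, Or.inr ⟨h3.1, fun s h6 h7 => hrun s h6 (by omega)⟩⟩
      · rw [(h2v t ht).2 h3]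
        by_cases h2 : p < t ∧ t ≤ j
        · obtain ⟨h3, h4⟩ := hval t h2.1 h2.2
          exact Or.inr ⟨h3, Or.inl h4⟩
        · exact Or.inl ((h1v t ht).2 h2)

/-! ### Two criteria for radical ideals. -/

section homogeneous
variable {σ k : Type*} [Field k]

attribute [local instance] MvPolynomial.gradedAlgebra

open MvPolynomial in
lemma homogeneousComponent_succ_X_mul (x : σ) (g : MvPolynomial σ k) (d : ℕ) :
    homogeneousComponent (d + 1) (X x * g) = X x * homogeneousComponent d g := by
  classical
  ext m
  rw [coeff_homogeneousComponent, coeff_X_mul', coeff_X_mul']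
  by_cases hx : x ∈ m.support
  · have h1 : Finsupp.single x 1 ≤ m := by
      rw [Finsupp.single_le_iff]; exact Nat.one_le_iff_ne_zero.2 (Finsupp.mem_support_iff.1 hx)
    have h2 : m.degree = (m - Finsupp.single x 1).degree + 1 := by
      conv_lhs => rw [← tsub_add_cancel_of_le h1]
      rw [map_add, Finsupp.degree_single]
    rw [if_pos hx, if_pos hx, coeff_homogeneousComponent, h2]
    simp
  · rw [if_neg hx, if_neg hx, ite_self]

open MvPolynomial in
lemma homogeneousComponent_zero_X_mul (x : σ) (g : MvPolynomial σ k) :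
    homogeneousComponent 0 (X x * g) = 0 := by
  classical
  rw [homogeneousComponent_zero, coeff_X_mul']
  simp

open MvPolynomial in
/-- A homogeneous ideal `I` is radical if `I + (x)` is radical for a variable `x` that is a
non-zero-divisor modulo the radical of `I`. -/
theorem isRadical_of_nonZeroDivisor {I : Ideal (MvPolynomial σ k)}
    (hI : I.IsHomogeneous (homogeneousSubmodule σ k)) (x : σ)
    (hx : (I ⊔ Ideal.span {X x}).IsRadical) (hnzd : ∀ g, X x * g ∈ I.radical → g ∈ I.radical) :
    I.IsRadical := by
  -- Write `f = i + x g` with `i ∈ I`. Then `x g`, hence `g`, is in the radical, and the relevant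
  -- component of `g` has smaller degree.
  have key : ∀ d, ∀ f : MvPolynomial σ k, f.IsHomogeneous d → f ∈ I.radical → f ∈ I := by
    intro d
    induction d with
    | zero =>
      intro f hf hfr
      obtain ⟨i, hi, y, hy, rfl⟩ := Submodule.mem_sup.1 (hx (Ideal.radical_mono le_sup_left hfr))
      obtain ⟨g, rfl⟩ := Ideal.mem_span_singleton'.1 hy
      rw [← homogeneousComponent_eq_self hf, map_add, mul_comm, homogeneousComponent_zero_X_mul,
        add_zero]
      exact homogeneousComponent_mem_of_mem hI hi 0
    | succ d ih =>
      intro f hf hfr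
      obtain ⟨i, hi, y, hy, hiy⟩ := Submodule.mem_sup.1 (hx (Ideal.radical_mono le_sup_left hfr))
      obtain ⟨g, rfl⟩ := Ideal.mem_span_singleton'.1 hy
      have hi' := homogeneousComponent_mem_of_mem hI hi (d + 1)
      have hf' : f = homogeneousComponent (d + 1) i + X x * homogeneousComponent d g := by
        rw [← homogeneousComponent_succ_X_mul, mul_comm, ← map_add, hiy,
          homogeneousComponent_eq_self hf]
      rw [hf']
      refine I.add_mem hi' (I.mul_mem_left _ (ih _ (homogeneousComponent_isHomogeneous _ _)
        (hnzd _ ?_)))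
      rw [← sub_eq_of_eq_add' hf']
      exact Ideal.sub_mem _ hfr (Ideal.le_radical hi')
  intro f hf
  rw [mem_iff_homogeneousComponent_mem hI]
  exact fun d => key d _ (homogeneousComponent_isHomogeneous _ _)
    (homogeneousComponent_mem_of_mem hI.radical hf d)

/-- If `f = i + x g` is in the radical of `I`, then `x g ∈ J`, so `g ∈ J`, and therefore `x g ∈ I`.
-/
theorem isRadical_of_mul_le {S : Type*} [CommRing S] {I J : Ideal S} (hJ : J.IsRadical)
    (hIJ : I ≤ J) (x : S) (hx : (I ⊔ Ideal.span {x}).IsRadical) (hxJ : ∀ g ∈ J, x * g ∈ I)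
    (hnzd : ∀ g, x * g ∈ J → g ∈ J) : I.IsRadical := by
  intro f hf
  obtain ⟨i, hi, y, hy, rfl⟩ := Submodule.mem_sup.1 (hx (Ideal.radical_mono le_sup_left hf))
  obtain ⟨g, rfl⟩ := Ideal.mem_span_singleton'.1 hy
  refine I.add_mem hi ?_
  rw [mul_comm]
  refine hxJ g (hnzd g ?_)
  have := J.sub_mem (hJ (Ideal.radical_mono hIJ hf)) (hIJ hi)
  rwa [add_sub_cancel_left, mul_comm] at this

end homogeneous

section rowOrd
variable {r n : ℕ}

lemma exists_rowOrd_eq (hn : n < 2 * r) : ∃ i₀ : Fin r × Bool, rowOrd i₀ = n := by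
  rcases Nat.even_or_odd' n with ⟨m, rfl | rfl⟩
  · exact ⟨(⟨m, by omega⟩, false), by simp [rowOrd]⟩
  · exact ⟨(⟨m, by omega⟩, true), by simp [rowOrd]⟩

lemma rowOrd_lt (i : Fin r × Bool) : rowOrd i < 2 * r := by
  have := i.1.isLt
  have : i.2.toNat ≤ 1 := Bool.toNat_le _
  unfold rowOrd; omega

lemma rowOrd_injective : Function.Injective (rowOrd (r := r)) := by
  rintro ⟨i, b⟩ ⟨i', b'⟩ h
  have h1 : b.toNat ≤ 1 := Bool.toNat_le _
  have h2 : b'.toNat ≤ 1 := Bool.toNat_le _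
  simp only [rowOrd] at h
  have h3 : i = i' := Fin.ext (by omega)
  have h4 : b.toNat = b'.toNat := by omega
  cases b <;> cases b' <;> simp_all

end rowOrd

/-! ### Homogeneity and good points. -/

section schubert
variable {k : Type*} [Field k] {r n j : ℕ} {ρ : ℕ → ℕ}

attribute [local instance] MvPolynomial.gradedAlgebra

open MvPolynomial in
lemma schubertIdeal_isHomogeneous :
    (schubertIdeal k r n j ρ).IsHomogeneous (homogeneousSubmodule _ k) := by
  refine Ideal.homogeneous_span _ _ ?_
  rintro p (⟨i, i'⟩ | ⟨x, y⟩ | ⟨t, ht, f, g, hg⟩ | ⟨i, x, h⟩)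
  · refine ⟨2, IsHomogeneous.sum _ _ _ fun x _ => ?_⟩
    have h1 := (isHomogeneous_X k (i, x)).mul (isHomogeneous_X k (i', x.rev))
    simp only [flagSign]
    split_ifs
    · simpa using h1
    · simpa using h1.neg
  · refine ⟨2, IsHomogeneous.sum _ _ _ fun m _ => ?_⟩
    exact ((isHomogeneous_X k _).mul (isHomogeneous_X k _)).sub
      ((isHomogeneous_X k _).mul (isHomogeneous_X k _))
  · refine ⟨ρ t + 1, ?_⟩
    rw [Matrix.det_apply]
    refine IsHomogeneous.sum _ _ _ fun s _ => ?_
    have h1 : (∏ i, ((genericM k r).submatrix f g) (s i) i).IsHomogeneous (ρ t + 1) := by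
      have := IsHomogeneous.prod Finset.univ (fun i => ((genericM k r).submatrix f g) (s i) i)
        (fun _ => 1) (fun i _ => isHomogeneous_X k _)
      simpa using this
    rcases Int.units_eq_one_or (Equiv.Perm.sign s) with h | h <;> rw [h]
    · simpa using h1
    · simpa using h1.neg
  · exact ⟨1, isHomogeneous_X k _⟩

/-- The coordinate of order `n` and column `j` is a non-zero-divisor at `C`, in the sense that
every polynomial which becomes nilpotent modulo `schubertIdeal` after multiplication by it
vanishes at `C`. -/
def IsGoodPoint (k : Type*) [Field k] {r : ℕ} (n j : ℕ) (ρ : ℕ → ℕ) {K : Type*} [Field K]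
    (ι : k →+* K) (C : Matrix (Fin r × Bool) (Fin (2 * r)) K) : Prop :=
  ∀ (i₀ : Fin r × Bool) (x : Fin (2 * r)), rowOrd i₀ = n → x.val = j →
    ∀ g : MvPolynomial ((Fin r × Bool) × Fin (2 * r)) k,
      MvPolynomial.X (i₀, x) * g ∈ (schubertIdeal k r n j ρ).radical →
      MvPolynomial.eval₂Hom ι (fun p => C p.1 p.2) g = 0

lemma genericM_map_eval₂Hom {K : Type*} [CommRing K] (ι : k →+* K)
    (C : Matrix (Fin r × Bool) (Fin (2 * r)) K) :
    (genericM k r).map (MvPolynomial.eval₂Hom ι fun p => C p.1 p.2) = C := by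
  ext i x; simp

lemma SchubertSat.radical_le_ker {K : Type*} [Field K] (ι : k →+* K)
    {C : Matrix (Fin r × Bool) (Fin (2 * r)) K} (hC : SchubertSat n j ρ C) :
    (schubertIdeal k r n j ρ).radical ≤
      RingHom.ker (MvPolynomial.eval₂Hom ι fun p => C p.1 p.2) := by
  refine (Ideal.radical_mono ((schubertIdeal_le_ker_iff _).2 ?_)).trans
    (RingHom.ker_isPrime _).isRadical
  rwa [genericM_map_eval₂Hom]

lemma SchubertSat.isGoodPoint_of_ne_zero {K : Type*} [Field K] (ι : k →+* K)
    {C : Matrix (Fin r × Bool) (Fin (2 * r)) K} (hC : SchubertSat n j ρ C)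
    (h : ∀ (i₀ : Fin r × Bool) (x : Fin (2 * r)), rowOrd i₀ = n → x.val = j → C i₀ x ≠ 0) :
    IsGoodPoint k n j ρ ι C := by
  intro i₀ x hi hx g hg
  have h1 := hC.radical_le_ker ι hg
  rw [RingHom.mem_ker, map_mul] at h1
  refine (mul_eq_zero.1 h1).resolve_left ?_
  simpa using h i₀ x hi hx

-- A polynomial that vanishes at the generic point of the line `C + τ B` vanishes on the line over
-- `K[τ]`, in particular at `τ = 0`.
open Polynomial in
lemma isGoodPoint_of_deformation {K : Type*} [Field K] (ι : k →+* K)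
    (C B : Matrix (Fin r × Bool) (Fin (2 * r)) K)
    (h : IsGoodPoint k n j ρ ((algebraMap K (FractionRing K[X])).comp ι)
      (C.map (algebraMap K (FractionRing K[X])) + algebraMap K[X] (FractionRing K[X]) X •
        B.map (algebraMap K (FractionRing K[X])))) :
    IsGoodPoint k n j ρ ι C := by
  intro i₀ x hi hx g hg
  let D : Matrix (Fin r × Bool) (Fin (2 * r)) K[X] :=
    Matrix.of fun i x => Polynomial.C (C i x) + X * Polynomial.C (B i x)
  let φ : MvPolynomial ((Fin r × Bool) × Fin (2 * r)) k →+* K[X] :=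
    MvPolynomial.eval₂Hom (Polynomial.C.comp ι) fun p => D p.1 p.2
  have halg : ∀ a : K, algebraMap K[X] (FractionRing K[X]) (Polynomial.C a) =
      algebraMap K (FractionRing K[X]) a := fun a =>
    (IsScalarTower.algebraMap_apply K K[X] (FractionRing K[X]) a).symm
  have h1 : φ g = 0 := by
    refine IsFractionRing.injective K[X] (FractionRing K[X]) ?_
    rw [map_zero, ← h i₀ x hi hx g hg, ← RingHom.comp_apply]
    congr 1
    refine MvPolynomial.ringHom_ext (fun a => ?_) fun p => ?_
    · simp [φ, halg]
    · simp [φ, D, halg]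
      rw [mul_comm, Algebra.smul_def]
  have h2 : MvPolynomial.eval₂Hom ι (fun p => C p.1 p.2) = (Polynomial.evalRingHom 0).comp φ := by
    refine MvPolynomial.ringHom_ext (fun a => ?_) fun p => ?_
    · simp [φ]
    · simp [φ, D]
  rw [h2, RingHom.comp_apply, h1, map_zero]

end schubert

/-! ### Column spans and pivots over a field. -/

section colSpan
variable {F : Type*} [Field F] {r : ℕ}

/-- The span of the first `t` columns. -/
def colSpan (C : Matrix (Fin r × Bool) (Fin (2 * r)) F) (t : ℕ) : Submodule F (Fin r × Bool → F) :=
  Submodule.span F (Cᵀ '' {x | x.val < t})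

/-- The rank of the first `t` columns. -/
noncomputable def colRank (C : Matrix (Fin r × Bool) (Fin (2 * r)) F) (t : ℕ) : ℕ :=
  Module.finrank F (colSpan C t)

/-- A column that is independent of the preceding ones. -/
def IsPivot (C : Matrix (Fin r × Bool) (Fin (2 * r)) F) (x : Fin (2 * r)) : Prop :=
  Cᵀ x ∉ colSpan C x.val

variable {C D : Matrix (Fin r × Bool) (Fin (2 * r)) F}

lemma col_mem_colSpan {t : ℕ} {x : Fin (2 * r)} (hx : x.val < t) : Cᵀ x ∈ colSpan C t :=
  Submodule.subset_span ⟨x, hx, rfl⟩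

lemma colSpan_mono {s t : ℕ} (h : s ≤ t) : colSpan C s ≤ colSpan C t :=
  Submodule.span_mono (Set.image_mono fun _ hx => lt_of_lt_of_le hx h)

lemma colSpan_le {t : ℕ} {W : Submodule F (Fin r × Bool → F)} (h : ∀ x, x.val < t → Cᵀ x ∈ W) :
    colSpan C t ≤ W :=
  Submodule.span_le.2 fun _ ⟨x, hx, hxv⟩ => hxv ▸ h x hx

lemma colSpan_succ (x : Fin (2 * r)) :
    colSpan C (x.val + 1) = colSpan C x.val ⊔ Submodule.span F {Cᵀ x} := by
  refine le_antisymm (colSpan_le fun y hy => ?_)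
    (sup_le (colSpan_mono (Nat.le_succ _)) ?_)
  · rcases Nat.lt_succ_iff_lt_or_eq.1 hy with h | h
    · exact Submodule.mem_sup_left (col_mem_colSpan h)
    · rw [Fin.ext h]
      exact Submodule.mem_sup_right (Submodule.mem_span_singleton_self _)
  · rw [Submodule.span_singleton_le_iff_mem]
    exact col_mem_colSpan (Nat.lt_succ_self _)

lemma finrank_sup_span_singleton_le (W : Submodule F (Fin r × Bool → F)) (v : Fin r × Bool → F) :
    Module.finrank F ↥(W ⊔ Submodule.span F {v}) ≤ Module.finrank F W + 1 :=
  (Submodule.finrank_add_le_finrank_add_finrank _ _).trans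
    (Nat.add_le_add_left ((finrank_span_le_card {v}).trans (by simp)) _)

lemma colSpan_succ_of_not_isPivot {x : Fin (2 * r)} (h : ¬ IsPivot C x) :
    colSpan C (x.val + 1) = colSpan C x.val := by
  rw [colSpan_succ, sup_eq_left, Submodule.span_singleton_le_iff_mem]
  exact not_not.1 h

lemma colRank_succ_of_isPivot {x : Fin (2 * r)} (h : IsPivot C x) :
    colRank C (x.val + 1) = colRank C x.val + 1 := by
  refine le_antisymm ?_ (Submodule.finrank_lt_finrank_of_lt ?_)
  · rw [colRank, colSpan_succ]; exact finrank_sup_span_singleton_le _ _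
  · refine lt_of_le_of_ne (colSpan_mono (Nat.le_succ _)) fun h' => h ?_
    rw [h']
    exact col_mem_colSpan (Nat.lt_succ_self _)

lemma colSpan_eq_of_not_isPivot {s t : ℕ} (hst : s ≤ t) (ht : t ≤ 2 * r)
    (h : ∀ x : Fin (2 * r), s ≤ x.val → x.val < t → ¬ IsPivot C x) :
    colSpan C t = colSpan C s := by
  induction t, hst using Nat.le_induction with
  | base => rfl
  | succ t hst ih =>
    rw [← ih (by omega) fun x h1 h2 => h x h1 (by omega)]
    exact colSpan_succ_of_not_isPivot (x := ⟨t, by omega⟩) (h _ hst (Nat.lt_succ_self t))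

lemma colRank_eq_of_isPivot {s t : ℕ} (hst : s ≤ t) (ht : t ≤ 2 * r)
    (h : ∀ x : Fin (2 * r), s ≤ x.val → x.val < t → IsPivot C x) :
    colRank C t = colRank C s + (t - s) := by
  induction t, hst using Nat.le_induction with
  | base => simp
  | succ t hst ih =>
    have h1 := ih (by omega) fun x h1 h2 => h x h1 (by omega)
    have h2 := colRank_succ_of_isPivot (x := ⟨t, by omega⟩) (h _ hst (Nat.lt_succ_self t))
    dsimp only at h2
    omega

lemma isPivot_iff {x : Fin (2 * r)} : IsPivot C x ↔
    ∃ v : Fin r × Bool → F, (∀ y < x, v ⬝ᵥ Cᵀ y = 0) ∧ v ⬝ᵥ Cᵀ x ≠ 0 := by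
  constructor
  · intro h
    obtain ⟨f, hf, hle⟩ := Submodule.exists_le_ker_of_notMem h
    have hdot : ∀ w, (fun i => f (Pi.single i 1)) ⬝ᵥ w = f w := by
      intro w
      conv_rhs => rw [pi_eq_sum_univ' w]
      simp [dotProduct, mul_comm]
    refine ⟨fun i => f (Pi.single i 1), fun y hy => ?_, ?_⟩
    · rw [hdot]; exact hle (col_mem_colSpan hy)
    · rwa [hdot]
  · rintro ⟨v, hv, hx⟩ hmem
    refine hx ?_
    have : colSpan C x.val ≤ LinearMap.ker (dotProductBilin F F v) :=
      colSpan_le fun y hy => hv y hy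
    exact this hmem

lemma not_isPivot_iff {x : Fin (2 * r)} : ¬ IsPivot C x ↔
    ∃ y : Fin (2 * r) → F, (∀ i, C i ⬝ᵥ y = 0) ∧ y x = 1 ∧ ∀ k, x < k → y k = 0 := by
  rw [IsPivot, not_not]
  constructor
  · intro h
    obtain ⟨l, hl, hlx⟩ := (Finsupp.mem_span_image_iff_linearCombination F
      (v := fun y => Cᵀ y)).1 h
    have hlz : ∀ k, ¬ k < x → l k = 0 := fun k hk => by
      by_contra hne
      exact hk (hl (Finsupp.mem_support_iff.2 hne))
    refine ⟨Pi.single x 1 - ⇑l, fun i => ?_, ?_, fun k hk => ?_⟩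
    · rw [dotProduct_sub, dotProduct_single_one, sub_eq_zero]
      have := congrFun hlx i
      rw [Finsupp.linearCombination_apply, Finsupp.sum_fintype _ _ (by simp)] at this
      rw [← Matrix.transpose_apply C, ← this, Finset.sum_apply]
      exact Finset.sum_congr rfl fun k _ => by simp [mul_comm]
    · simp [hlz x (lt_irrefl x)]
    · simp [hlz k hk.not_gt, hk.ne']
  · rintro ⟨y, hy, hx, hz⟩
    have : Cᵀ x = - ∑ k ∈ Finset.univ.erase x, y k • Cᵀ k := by
      ext i
      have := hy i
      rw [dotProduct, ← Finset.add_sum_erase _ _ (Finset.mem_univ x), hx, mul_one] at this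
      rw [Pi.neg_apply, Finset.sum_apply, Matrix.transpose_apply, eq_neg_of_add_eq_zero_left this]
      simp [mul_comm]
    rw [this]
    refine Submodule.neg_mem _ (Submodule.sum_mem _ fun k hk => ?_)
    rcases lt_trichotomy k x with h | h | h
    · exact Submodule.smul_mem _ _ (col_mem_colSpan h)
    · exact absurd h (Finset.mem_erase.1 hk).1
    · rw [hz k h, zero_smul]; exact Submodule.zero_mem _

section map
variable {K : Type*} [Field K] (φ : F →+* K)

lemma map_dotProduct' {m : Type*} [Fintype m] (u v : m → F) :
    (fun i => φ (u i)) ⬝ᵥ (fun i => φ (v i)) = φ (u ⬝ᵥ v) := by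
  simp [dotProduct]

lemma not_isPivot_map {x : Fin (2 * r)} (h : ¬ IsPivot C x) : ¬ IsPivot (C.map φ) x := by
  obtain ⟨y, hy, hx, hz⟩ := not_isPivot_iff.1 h
  refine not_isPivot_iff.2 ⟨fun k => φ (y k), fun i => ?_, by simp [hx], fun k hk => by
    simp [hz k hk]⟩
  exact (map_dotProduct' φ (C i) y).trans (by rw [hy i, map_zero])

end map

lemma flagForm_vecMul (u : Fin (2 * r) → F) (v : Fin r × Bool → F) :
    flagForm u (v ᵥ* C) = ∑ i, v i * flagForm u (C i) := by
  simp only [flagForm, Matrix.vecMul, dotProduct, Finset.mul_sum]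
  rw [Finset.sum_comm]
  exact Finset.sum_congr rfl fun i _ => Finset.sum_congr rfl fun k _ => by ring

/-- A pivot at `x` yields a vector of the row space with leading position `x`. It is orthogonal to
all rows, and its mirror image is a relation among the columns ending at `x.rev`. -/
lemma not_isPivot_rev (hC : ∀ i i', flagForm (C i) (C i') = 0) {x : Fin (2 * r)}
    (h : IsPivot C x) : ¬ IsPivot C x.rev := by
  obtain ⟨v, hv, hx⟩ := isPivot_iff.1 h
  have hu : ∀ k, (v ᵥ* C) k = v ⬝ᵥ Cᵀ k := fun k => rfl
  rw [not_isPivot_iff]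
  refine ⟨fun k => (v ⬝ᵥ Cᵀ x)⁻¹ * flagSign F x.rev * (flagSign F k * (v ᵥ* C) k.rev), fun i => ?_,
    ?_, fun k hk => ?_⟩
  · have h0 : flagForm (C i) (v ᵥ* C) = 0 := by
      rw [flagForm_vecMul]; exact Finset.sum_eq_zero fun i' _ => by rw [hC, mul_zero]
    have h1 : C i ⬝ᵥ (fun k => (v ⬝ᵥ Cᵀ x)⁻¹ * flagSign F x.rev * (flagSign F k * (v ᵥ* C) k.rev)) =
        (v ⬝ᵥ Cᵀ x)⁻¹ * flagSign F x.rev * flagForm (C i) (v ᵥ* C) := by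
      rw [flagForm, Finset.mul_sum]
      exact Finset.sum_congr rfl fun k _ => by ring
    rw [h1, h0, mul_zero]
  · dsimp only
    rw [Fin.rev_rev, hu, mul_assoc, ← mul_assoc (flagSign F x.rev), flagSign_mul_self, one_mul,
      inv_mul_cancel₀ hx]
  · dsimp only
    rw [hu, hv k.rev (by rw [← Fin.rev_lt_rev, Fin.rev_rev]; exact hk)]
    simp

/-- The relation expressing column `x.rev` by earlier columns, read through the form. -/
lemma exists_perp {x : Fin (2 * r)} (h : ¬ IsPivot C x.rev) : ∃ e : Fin (2 * r) → F,
    (∀ i, flagForm (C i) e = 0) ∧ e x = 1 ∧ ∀ k < x, e k = 0 := by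
  obtain ⟨y, hy, hx, hz⟩ := not_isPivot_iff.1 h
  refine ⟨(- flagSign F x) • flagDual y, fun i => ?_, ?_, fun k hk => ?_⟩
  · rw [flagForm_smul_right, flagForm_flagDual, hy, mul_zero]
  · have := flagSign_mul_self (A := F) x
    simp [flagDual, hx, this]
  · simp [flagDual, hz k.rev (Fin.rev_lt_rev.2 hk)]

/-- Vanishing of minors in terms of the column rank. -/
lemma minors_eq_zero_iff {t l : ℕ} :
    (∀ (f : Fin (l + 1) → Fin r × Bool) (g : Fin (l + 1) → Fin (2 * r)), (∀ i, (g i).val < t) →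
      (C.submatrix f g).det = 0) ↔ colRank C t ≤ l := by
  constructor
  · intro h
    by_contra hlt
    push Not at hlt
    obtain ⟨g, hg, hli⟩ : ∃ g : Fin (l + 1) → Fin (2 * r), (∀ i, (g i).val < t) ∧
        LinearIndependent F fun i => Cᵀ (g i) := by
      obtain ⟨b, hb, -, hli⟩ := Submodule.exists_fun_fin_finrank_span_eq F (Cᵀ '' {x | x.val < t})
      choose g hg hgb using hb
      have hlt' : l + 1 ≤ Module.finrank F (Submodule.span F (Cᵀ '' {x | x.val < t})) := hlt
      refine ⟨fun i => g (Fin.castLE hlt' i), fun i => hg _, ?_⟩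
      simp only [hgb]
      exact hli.comp _ (Fin.castLE_injective hlt')
    have hrank : (C.submatrix id g).rank = l + 1 := by
      rw [← Matrix.rank_transpose]
      have := LinearIndependent.rank_matrix (M := (C.submatrix id g)ᵀ) hli
      simpa using this
    obtain ⟨b, hb, -, hli⟩ :=
      Submodule.exists_fun_fin_finrank_span_eq F (Set.range (C.submatrix id g).row)
    rw [Matrix.rank_eq_finrank_span_row] at hrank
    generalize Module.finrank F (Submodule.span F (Set.range (C.submatrix id g).row)) = d at *
    subst hrank
    choose f hf using hb
    have hrow : (C.submatrix f g).row = b := funext hf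
    have hunit := Matrix.linearIndependent_rows_iff_isUnit.1 (hrow ▸ hli)
    exact ((Matrix.isUnit_iff_isUnit_det _).1 hunit).ne_zero (h f g hg)
  · intro h f g hg
    by_contra hdet
    have hli : LinearIndependent F (fun i => Cᵀ (g i)) := by
      have h1 : LinearIndependent F (C.submatrix f g).col :=
        Matrix.linearIndependent_cols_of_det_ne_zero hdet
      exact LinearIndependent.of_comp (LinearMap.funLeft F F f) h1
    have h2 : Submodule.span F (Set.range fun i => Cᵀ (g i)) ≤ colSpan C t :=
      Submodule.span_le.2 (by rintro _ ⟨i, rfl⟩; exact col_mem_colSpan (hg i))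
    have h3 := Submodule.finrank_mono h2
    rw [finrank_span_eq_card hli, Fintype.card_fin] at h3
    exact absurd (h3.trans h) (by omega)

end colSpan

/-! ### Deformation by symplectic row operations. -/

section pivotDeform
variable {F : Type*} [Field F] {r n j : ℕ} {ρ : ℕ → ℕ} {C : Matrix (Fin r × Bool) (Fin (2 * r)) F}

lemma schubertSat_iff_colRank : SchubertSat n j ρ C ↔
    (∀ i i', flagForm (C i) (C i') = 0) ∧ (∀ k l, pairForm (Cᵀ k) (Cᵀ l) = 0) ∧
    (∀ t ≤ 2 * r, colRank C t ≤ ρ t) ∧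
    (∀ i k, rowOrd i < n ∨ rowOrd i = n ∧ k.val < j → C i k = 0) := by
  rw [schubertSat_iff]
  simp only [← minors_eq_zero_iff]

lemma colRank_map_le {K : Type*} [Field K] (φ : F →+* K) (t : ℕ) :
    colRank (C.map φ) t ≤ colRank C t := by
  rw [← minors_eq_zero_iff]
  intro f g hg
  have h := minors_eq_zero_iff.2 (le_refl (colRank C t)) f g hg
  rw [Matrix.submatrix_map, ← RingHom.mapMatrix_apply, ← RingHom.map_det, h, map_zero]

lemma colRank_mul_le (G : Matrix (Fin r × Bool) (Fin r × Bool) F) (t : ℕ) :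
    colRank (G * C) t ≤ colRank C t := by
  refine (Submodule.finrank_mono (colSpan_le (C := G * C) fun x hx => ?_)).trans
    (Submodule.finrank_map_le G.mulVecLin (colSpan C t))
  exact ⟨Cᵀ x, col_mem_colSpan hx, rfl⟩

lemma flagForm_mul (hC : ∀ i i', flagForm (C i) (C i') = 0)
    (G : Matrix (Fin r × Bool) (Fin r × Bool) F) (i i' : Fin r × Bool) :
    flagForm ((G * C) i) ((G * C) i') = 0 := by
  change flagForm (G i ᵥ* C) (G i' ᵥ* C) = 0
  rw [flagForm_vecMul]
  refine Finset.sum_eq_zero fun l _ => ?_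
  rw [flagForm_swap, flagForm_vecMul, Finset.sum_eq_zero fun l' _ => by rw [hC, mul_zero]]
  simp

/-- The row that is paired with `i`. -/
def rowPartner (i : Fin r × Bool) : Fin r × Bool := (i.1, !i.2)

/-- The sign of the pairing of `i` with `rowPartner i`. -/
def rowSign (F : Type*) [CommRing F] (i : Fin r × Bool) : F := if i.2 then -1 else 1

lemma rowPartner_ne (i : Fin r × Bool) : rowPartner i ≠ i := by
  rcases i with ⟨m, b⟩; cases b <;> simp [rowPartner]

lemma rowPartner_rowPartner (i : Fin r × Bool) : rowPartner (rowPartner i) = i := by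
  simp [rowPartner]

lemma rowOrd_rowPartner_le (i : Fin r × Bool) : rowOrd (rowPartner i) ≤ rowOrd i + 1 := by
  rcases i with ⟨m, b⟩; cases b <;> simp [rowPartner, rowOrd]; omega

lemma rowSign_mul_self (i : Fin r × Bool) : rowSign F i * rowSign F i = 1 := by
  unfold rowSign; split_ifs <;> simp

lemma pairDual_apply (v : Fin r × Bool → F) (i : Fin r × Bool) :
    pairDual v i = rowSign F i * v (rowPartner i) := by
  rcases i with ⟨m, b⟩; cases b <;> simp [pairDual, rowSign, rowPartner]

lemma pairForm_single_left (i : Fin r × Bool) (c : Fin r × Bool → F) :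
    pairForm (Pi.single i 1) c = rowSign F i * c (rowPartner i) := by
  have h : (Pi.single i 1 : Fin r × Bool → F) =
      pairDual (rowSign F i • Pi.single (rowPartner i) 1) := by
    ext i'
    rw [pairDual_apply]
    by_cases h : i' = i
    · subst h; simp [rowSign_mul_self]
    · have h' : rowPartner i' ≠ rowPartner i := fun h' => h (by
        rw [← rowPartner_rowPartner i', h', rowPartner_rowPartner])
      simp [h, h']
  rw [h, pairForm_pairDual, smul_dotProduct, single_one_dotProduct, smul_eq_mul]

/-- The functional `v` without its coordinates in the rows of order `< n`, the row `i₀` and its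
partner. -/
def truncFun (n : ℕ) (i₀ : Fin r × Bool) (v : Fin r × Bool → F) : Fin r × Bool → F :=
  fun i => if rowOrd i < n ∨ i = i₀ ∨ i = rowPartner i₀ then 0 else v i

/-- The infinitesimal row operation that moves the row `i₀` by the combination `v` of the rows. -/
def pivotDeform (n : ℕ) (i₀ : Fin r × Bool) (v : Fin r × Bool → F) :
    Matrix (Fin r × Bool) (Fin r × Bool) F :=
  Matrix.vecMulVec (Pi.single i₀ 1)
      (truncFun n i₀ v + v (rowPartner i₀) • Pi.single (rowPartner i₀) 1) +
    Matrix.vecMulVec (pairDual (truncFun n i₀ v)) (rowSign F i₀ • Pi.single (rowPartner i₀) 1)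

lemma map_rowSign {K : Type*} [Field K] (φ : F →+* K) (i : Fin r × Bool) :
    φ (rowSign F i) = rowSign K i := by
  unfold rowSign; split_ifs <;> simp

lemma map_truncFun {K : Type*} [Field K] (φ : F →+* K) (i₀ : Fin r × Bool)
    (v : Fin r × Bool → F) (i : Fin r × Bool) :
    φ (truncFun n i₀ v i) = truncFun n i₀ (fun i => φ (v i)) i := by
  unfold truncFun; split_ifs <;> simp

lemma map_single_one {K : Type*} [Field K] (φ : F →+* K) {m : Type*} [DecidableEq m] (i i' : m) :
    φ ((Pi.single i 1 : m → F) i') = (Pi.single i 1 : m → K) i' := by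
  simp only [Pi.single_apply]; split_ifs <;> simp

lemma pivotDeform_map {K : Type*} [Field K] (φ : F →+* K) (i₀ : Fin r × Bool)
    (v : Fin r × Bool → F) :
    (pivotDeform n i₀ v).map φ = pivotDeform n i₀ fun i => φ (v i) := by
  ext i l
  simp only [pivotDeform, Matrix.map_apply, Matrix.add_apply, Matrix.vecMulVec_apply,
    pairDual_apply, map_add, map_mul, map_rowSign, map_truncFun, map_single_one, Pi.add_apply,
    Pi.smul_apply, smul_eq_mul]

lemma pivotDeform_mul_apply (i₀ : Fin r × Bool) (v : Fin r × Bool → F) (i : Fin r × Bool)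
    (k : Fin (2 * r)) : (pivotDeform n i₀ v * C) i k =
      (Pi.single i₀ 1 : Fin r × Bool → F) i *
        (truncFun n i₀ v ⬝ᵥ Cᵀ k + v (rowPartner i₀) * C (rowPartner i₀) k) +
      pairDual (truncFun n i₀ v) i * pairForm (Pi.single i₀ 1) (Cᵀ k) := by
  rw [pivotDeform, Matrix.add_mul, Matrix.vecMulVec_mul, Matrix.vecMulVec_mul, Matrix.add_vecMul,
    Matrix.smul_vecMul, Matrix.smul_vecMul, Matrix.single_one_vecMul, pairForm_single_left]
  rfl

/-- With `e` the basis vector at `i₀`, `β` dual to the truncated `v` and `ω` the form, `pivotDeform`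
maps `c` to `ω(β, c) e + ω(e, c) β` plus a multiple of `ω(e, c) e`. It lies in the symplectic Lie
algebra and its image is in the isotropic span of `e` and `β`, so `1 + τ • pivotDeform` preserves
`ω` exactly. Row operations keep row isotropy and do not increase column ranks. -/
lemma schubertSat_pivotDeform (hC : SchubertSat n j ρ C) {i₀ : Fin r × Bool} (hi₀ : rowOrd i₀ = n)
    {x : Fin (2 * r)} (hx : x.val = j) (h0 : C i₀ x = 0) {v : Fin r × Bool → F}
    (hv : ∀ y < x, v ⬝ᵥ Cᵀ y = 0) (τ : F) :
    SchubertSat n j ρ (C + τ • (pivotDeform n i₀ v * C)) ∧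
      (C + τ • (pivotDeform n i₀ v * C)) i₀ x = τ * (v ⬝ᵥ Cᵀ x) := by
  obtain ⟨h1, h2, h3, h4⟩ := schubertSat_iff_colRank.1 hC
  have hG : C + τ • (pivotDeform n i₀ v * C) = (1 + τ • pivotDeform n i₀ v) * C := by
    rw [Matrix.add_mul, Matrix.one_mul, Matrix.smul_mul]
  -- Up to column `x` the truncation loses nothing: the rows of order `< n` and row `i₀` vanish
  -- there, and the partner is added back.
  have hU : ∀ k ≤ x, truncFun n i₀ v ⬝ᵥ Cᵀ k + v (rowPartner i₀) * C (rowPartner i₀) k =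
      v ⬝ᵥ Cᵀ k := by
    intro k hk
    have h5 : C i₀ k = 0 := by
      rcases hk.lt_or_eq with h | rfl
      · exact h4 _ _ (Or.inr ⟨hi₀, hx ▸ h⟩)
      · exact h0
    rw [← single_one_dotProduct (rowPartner i₀) (fun i => v i * C i k)]
    simp only [dotProduct]
    rw [← Finset.sum_add_distrib]
    refine Finset.sum_congr rfl fun i _ => ?_
    simp only [truncFun, Matrix.transpose_apply]
    by_cases ha : i = rowPartner i₀
    · subst ha; simp
    · by_cases hb : i = i₀
      · subst hb; simp [h5, (rowPartner_ne i).symm]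
      · by_cases hc : rowOrd i < n
        · simp [h4 i k (Or.inl hc)]
        · simp [ha, hb, hc]
  -- The correction term only touches rows of order `> n`, so the prescribed zeros survive.
  have hβ : ∀ i, rowOrd i ≤ n → pairDual (truncFun n i₀ v) i = 0 := by
    intro i hi
    rw [pairDual_apply]
    have : rowOrd (rowPartner i) < n ∨ rowPartner i = i₀ ∨ rowPartner i = rowPartner i₀ := by
      rcases hi.lt_or_eq with h | h
      · have := rowOrd_rowPartner_le i
        rcases Nat.lt_or_ge (rowOrd (rowPartner i)) n with h' | h'
        · exact Or.inl h'
        · exact Or.inr (Or.inl (rowOrd_injective (by omega)))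
      · rw [rowOrd_injective (h.trans hi₀.symm)]; exact Or.inr (Or.inr rfl)
    simp [truncFun, this]
  refine ⟨schubertSat_iff_colRank.2 ⟨?_, fun k l => ?_, fun t ht => ?_, fun i k hik => ?_⟩, ?_⟩
  · rw [hG]; exact flagForm_mul h1 _
  · have hD : ∀ k, (C + τ • (pivotDeform n i₀ v * C))ᵀ k = Cᵀ k + τ •
        ((truncFun n i₀ v ⬝ᵥ Cᵀ k + v (rowPartner i₀) * C (rowPartner i₀) k) • Pi.single i₀ 1 +
        pairForm (Pi.single i₀ 1) (Cᵀ k) • pairDual (truncFun n i₀ v)) := by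
      intro k
      ext i
      simp only [Matrix.transpose_apply, Matrix.add_apply, Matrix.smul_apply,
        pivotDeform_mul_apply, Pi.add_apply, Pi.smul_apply, smul_eq_mul]
      ring
    have hs : ∀ k, C (rowPartner i₀) k = rowSign F i₀ * pairForm (Pi.single i₀ 1) (Cᵀ k) := by
      intro k
      rw [pairForm_single_left, ← mul_assoc, rowSign_mul_self, one_mul]; rfl
    have hβ' : truncFun n i₀ v ⬝ᵥ Pi.single i₀ 1 = 0 := by
      rw [dotProduct_single_one]
      simp [truncFun]
    have hβ'' : pairForm (Pi.single i₀ 1) (pairDual (truncFun n i₀ v)) = 0 := by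
      rw [pairForm_swap, pairForm_pairDual, hβ', neg_zero]
    simp only [hD, pairForm_add_left, pairForm_add_right, pairForm_smul_left, pairForm_smul_right,
      pairForm_self, h2, pairForm_swap (Cᵀ k) (Pi.single i₀ 1),
      pairForm_swap (Cᵀ k) (pairDual _),
      pairForm_pairDual, hβ', hβ'', hs]
    ring
  · rw [hG]; exact (colRank_mul_le _ t).trans (h3 t ht)
  · rw [Matrix.add_apply, h4 i k hik, Matrix.smul_apply, pivotDeform_mul_apply,
      hβ i (by omega), zero_mul, add_zero, zero_add]
    rcases hik with h | ⟨h, hk⟩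
    · rw [Pi.single_eq_of_ne (by rintro rfl; omega)]; simp
    · have hk' : k < x := by rw [Fin.lt_def]; omega
      rw [hU k hk'.le, hv k hk']; simp
  · rw [Matrix.add_apply, h0, Matrix.smul_apply, pivotDeform_mul_apply, hβ _ hi₀.le, hU x le_rfl]
    simp

end pivotDeform

section goodPoint
variable {k : Type*} [Field k] {r n j : ℕ} {ρ : ℕ → ℕ} {K : Type*} [Field K] (ι : k →+* K)
  {C : Matrix (Fin r × Bool) (Fin (2 * r)) K}

-- For a functional `v` vanishing on the columns before `x` but not on column `x`, adding `τ v` to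
-- row `i₀` keeps its initial zeros and makes the entry at `x` nonzero.
open Polynomial in
lemma isGoodPoint_of_isPivot (hC : SchubertSat n j ρ C) {x : Fin (2 * r)} (hx : x.val = j)
    (hp : IsPivot C x) : IsGoodPoint k n j ρ ι C := by
  by_cases hex : ∃ i₀ : Fin r × Bool, rowOrd i₀ = n ∧ C i₀ x = 0
  · obtain ⟨i₀, hi₀, h0⟩ := hex
    obtain ⟨v, hv, hvx⟩ := isPivot_iff.1 hp
    refine isGoodPoint_of_deformation ι C (pivotDeform n i₀ v * C) ?_
    set φ := algebraMap K (FractionRing K[X])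
    set τ := algebraMap K[X] (FractionRing K[X]) X
    have hτ : τ ≠ 0 := by
      simp [τ]
    rw [Matrix.map_mul, pivotDeform_map]
    have hdot : ∀ y, (fun i => φ (v i)) ⬝ᵥ (C.map φ)ᵀ y = φ (v ⬝ᵥ Cᵀ y) := fun y =>
      map_dotProduct' φ v (Cᵀ y)
    obtain ⟨hs, hne⟩ := schubertSat_pivotDeform (hC.map φ) hi₀ hx (by simp [h0])
      (v := fun i => φ (v i)) (fun y hy => by rw [hdot, hv y hy, map_zero]) τ
    refine hs.isGoodPoint_of_ne_zero _ fun i y hi hy => ?_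
    rw [rowOrd_injective (hi.trans hi₀.symm), Fin.ext (hy.trans hx.symm), hne, hdot]
    exact mul_ne_zero hτ ((map_ne_zero φ).2 hvx)
  · push Not at hex
    refine hC.isGoodPoint_of_ne_zero ι fun i y hi hy => ?_
    rw [Fin.ext (hy.trans hx.symm)]
    exact hex i hi

end goodPoint

/-! ### Deformations along lines. -/

section deformation
variable {F : Type*} [Field F] {r n j : ℕ} {ρ : ℕ → ℕ}
  {C B : Matrix (Fin r × Bool) (Fin (2 * r)) F}

/-- Sufficient conditions on `B` for all the matrices `C + τ • B` to satisfy `SchubertSat`. -/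
structure IsSchubertDeformation (n j : ℕ) (ρ : ℕ → ℕ)
    (C B : Matrix (Fin r × Bool) (Fin (2 * r)) F) : Prop where
  row : ∀ i i', flagForm (C i) (B i') = flagForm (C i') (B i)
  row_self : ∀ i i', flagForm (B i) (B i') = 0
  col : ∀ k l, pairForm (Cᵀ k) (Bᵀ l) = pairForm (Cᵀ l) (Bᵀ k)
  col_self : ∀ k l, pairForm (Bᵀ k) (Bᵀ l) = 0
  rank : ∀ t ≤ 2 * r, (∀ k : Fin (2 * r), k.val < t → Bᵀ k ∈ colSpan C t) ∨
    colRank C t + 1 ≤ ρ t ∧ ∃ γ : Fin r × Bool → F, ∀ k : Fin (2 * r), k.val < t →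
      ∃ a : F, Bᵀ k + a • γ ∈ colSpan C t
  zero : ∀ i k, rowOrd i < n ∨ rowOrd i = n ∧ k.val < j → B i k = 0

lemma map_mem_colSpan {K : Type*} [Field K] (φ : F →+* K) {t : ℕ} {w : Fin r × Bool → F}
    (hw : w ∈ colSpan C t) : (fun i => φ (w i)) ∈ colSpan (C.map φ) t := by
  induction hw using Submodule.span_induction with
  | mem w h =>
    obtain ⟨x, hx, rfl⟩ := h
    exact col_mem_colSpan (C := C.map φ) hx
  | zero =>
    simp only [Pi.zero_apply, map_zero]
    exact Submodule.zero_mem (colSpan (C.map φ) t)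
  | add u w _ _ hu hw =>
    simp only [Pi.add_apply, map_add]
    exact Submodule.add_mem _ hu hw
  | smul a w _ hw =>
    simp only [Pi.smul_apply, smul_eq_mul, map_mul]
    exact Submodule.smul_mem _ (φ a) hw

lemma IsSchubertDeformation.map {K : Type*} [Field K] (φ : F →+* K)
    (h : IsSchubertDeformation n j ρ C B) :
    IsSchubertDeformation n j ρ (C.map φ) (B.map φ) where
  row i i' := (map_flagForm φ (C i) (B i')).trans
    ((congrArg φ (h.row i i')).trans (map_flagForm φ (C i') (B i)).symm)
  row_self i i' := (map_flagForm φ (B i) (B i')).trans (by rw [h.row_self, map_zero])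
  col k l := (map_pairForm φ (Cᵀ k) (Bᵀ l)).trans
    ((congrArg φ (h.col k l)).trans (map_pairForm φ (Cᵀ l) (Bᵀ k)).symm)
  col_self k l := (map_pairForm φ (Bᵀ k) (Bᵀ l)).trans (by rw [h.col_self, map_zero])
  rank t ht := by
    rcases h.rank t ht with h1 | ⟨h1, γ, hγ⟩
    · exact Or.inl fun k hk => map_mem_colSpan φ (h1 k hk)
    · refine Or.inr ⟨(Nat.add_le_add_right (colRank_map_le φ t) 1).trans h1,
        fun i => φ (γ i), fun k hk => ?_⟩
      obtain ⟨a, ha⟩ := hγ k hk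
      refine ⟨φ a, ?_⟩
      convert map_mem_colSpan φ ha using 1
      ext i
      simp
  zero i k hik := by rw [Matrix.map_apply, h.zero i k hik, map_zero]

lemma IsSchubertDeformation.schubertSat (h : IsSchubertDeformation n j ρ C B)
    (hC : SchubertSat n j ρ C) (τ : F) : SchubertSat n j ρ (C + τ • B) := by
  obtain ⟨h1, h2, h3, h4⟩ := schubertSat_iff_colRank.1 hC
  refine schubertSat_iff_colRank.2 ⟨fun i i' => ?_, fun k l => ?_, fun t ht => ?_,
    fun i k hik => ?_⟩
  · change flagForm (C i + τ • B i) (C i' + τ • B i') = 0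
    rw [flagForm_add_left, flagForm_add_right, flagForm_add_right, flagForm_smul_left,
      flagForm_smul_left, flagForm_smul_right, flagForm_smul_right, h1, h.row_self, h.row i i',
      flagForm_swap (B i)]
    ring
  · change pairForm (Cᵀ k + τ • Bᵀ k) (Cᵀ l + τ • Bᵀ l) = 0
    rw [pairForm_add_left, pairForm_add_right, pairForm_add_right, pairForm_smul_left,
      pairForm_smul_left, pairForm_smul_right, pairForm_smul_right, h2, h.col_self, h.col k l,
      pairForm_swap (Bᵀ k)]
    ring
  · rcases h.rank t ht with h5 | ⟨h5, γ, hγ⟩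
    · refine (Submodule.finrank_mono (colSpan_le fun k hk => ?_)).trans (h3 t ht)
      exact Submodule.add_mem _ (col_mem_colSpan hk) (Submodule.smul_mem _ τ (h5 k hk))
    · refine (Submodule.finrank_mono (colSpan_le fun k hk => ?_)).trans
        ((finrank_sup_span_singleton_le (colSpan C t) γ).trans h5)
      obtain ⟨a, ha⟩ := hγ k hk
      have h6 : (C + τ • B)ᵀ k = (Cᵀ k + τ • (Bᵀ k + a • γ)) + (- (τ * a)) • γ := by
        ext i
        simp only [Matrix.transpose_apply, Matrix.add_apply, Matrix.smul_apply, Pi.add_apply,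
          Pi.smul_apply, smul_eq_mul]
        ring
      rw [h6]
      exact Submodule.add_mem_sup (Submodule.add_mem _ (col_mem_colSpan hk)
        (Submodule.smul_mem _ τ ha)) (Submodule.smul_mem _ _ (Submodule.mem_span_singleton_self γ))
  · rw [Matrix.add_apply, Matrix.smul_apply, h4 i k hik, h.zero i k hik, smul_zero, add_zero]

/-- Self-isotropy is automatic for a rank-one `B`, as both forms are alternating. `B` raises the
rank of the first `t` columns by at most one, and only if `e` is nonzero there and `γ` is not
already in the span. -/
lemma isSchubertDeformation_vecMulVec {γ : Fin r × Bool → F} {e : Fin (2 * r) → F}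
    (hrow : ∀ i i', γ i' * flagForm (C i) e = γ i * flagForm (C i') e)
    (hcol : ∀ k, pairForm (Cᵀ k) γ = 0)
    (hrank : ∀ t ≤ 2 * r, (∀ k : Fin (2 * r), k.val < t → e k = 0) ∨ γ ∈ colSpan C t ∨
      colRank C t + 1 ≤ ρ t)
    (hzero : ∀ i k, rowOrd i < n ∨ rowOrd i = n ∧ k.val < j → γ i * e k = 0) :
    IsSchubertDeformation n j ρ C (Matrix.vecMulVec γ e) := by
  have hr : ∀ i, Matrix.vecMulVec γ e i = γ i • e := fun i => rfl
  have hc : ∀ k, (Matrix.vecMulVec γ e)ᵀ k = e k • γ := fun k => by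
    ext i; simp [Matrix.vecMulVec_apply, mul_comm]
  constructor
  · intro i i'
    rw [hr, hr, flagForm_smul_right, flagForm_smul_right, hrow]
  · intro i i'
    rw [hr, hr, flagForm_smul_right, flagForm_smul_left, flagForm_self, mul_zero, mul_zero]
  · intro k l
    rw [hc, hc, pairForm_smul_right, pairForm_smul_right, hcol, hcol, mul_zero, mul_zero]
  · intro k l
    rw [hc, hc, pairForm_smul_right, pairForm_smul_left, pairForm_self, mul_zero, mul_zero]
  · intro t ht
    rcases hrank t ht with h | h | h
    · exact Or.inl fun k hk => by rw [hc, h k hk, zero_smul]; exact Submodule.zero_mem _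
    · exact Or.inl fun k hk => by rw [hc]; exact Submodule.smul_mem _ _ h
    · refine Or.inr ⟨h, γ, fun k hk => ⟨- e k, ?_⟩⟩
      rw [hc, ← add_smul, add_neg_cancel, zero_smul]; exact Submodule.zero_mem _
  · intro i k hik
    rw [Matrix.vecMulVec_apply, hzero i k hik]

end deformation

section goodPoint
variable {k : Type*} [Field k] {r n j : ℕ} {ρ : ℕ → ℕ} {K : Type*} [Field K] (ι : k →+* K)
  {C B : Matrix (Fin r × Bool) (Fin (2 * r)) K}

-- Column `x` becomes a pivot of `C + τ B`, so a second deformation, `isGoodPoint_of_isPivot`,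
-- applies.
open Polynomial in
lemma IsSchubertDeformation.isGoodPoint (h : IsSchubertDeformation n j ρ C B)
    (hC : SchubertSat n j ρ C) {x : Fin (2 * r)} (hx : x.val = j) {v : Fin r × Bool → K}
    (hv : ∀ y ≤ x, v ⬝ᵥ Cᵀ y = 0) (hvB : ∀ y < x, v ⬝ᵥ Bᵀ y = 0) (hvx : v ⬝ᵥ Bᵀ x ≠ 0) :
    IsGoodPoint k n j ρ ι C := by
  refine isGoodPoint_of_deformation ι C B ?_
  set φ := algebraMap K (FractionRing K[X])
  set τ := algebraMap K[X] (FractionRing K[X]) X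
  have hτ : τ ≠ 0 := by simp [τ]
  refine isGoodPoint_of_isPivot _ ((h.map φ).schubertSat (hC.map φ) τ) hx
    (isPivot_iff.2 ⟨fun i => φ (v i), ?_⟩)
  have hdot : ∀ y, (fun i => φ (v i)) ⬝ᵥ (C.map φ + τ • B.map φ)ᵀ y =
      φ (v ⬝ᵥ Cᵀ y) + τ * φ (v ⬝ᵥ Bᵀ y) := fun y => by
    have hD : (C.map φ + τ • B.map φ)ᵀ y =
      (fun i => φ (Cᵀ y i)) + τ • (fun i => φ (Bᵀ y i)) := rfl
    rw [hD, dotProduct_add, dotProduct_smul, map_dotProduct', map_dotProduct', smul_eq_mul]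
  refine ⟨fun y hy => ?_, ?_⟩
  · rw [hdot, hv y hy.le, hvB y hy]; simp
  · rw [hdot, hv x le_rfl, map_zero, zero_add]
    exact mul_ne_zero hτ ((map_ne_zero φ).2 hvx)

end goodPoint

/-! ### Case analysis on the pivots at a column and its mirror. -/

section cases
variable {k : Type*} [Field k] {r n j : ℕ} {ρ : ℕ → ℕ} {K : Type*} [Field K] (ι : k →+* K)
  {C B : Matrix (Fin r × Bool) (Fin (2 * r)) K}

lemma vecMulVec_transpose (γ : Fin r × Bool → K) (e : Fin (2 * r) → K) (y : Fin (2 * r)) :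
    (Matrix.vecMulVec γ e)ᵀ y = e y • γ := by
  ext i; simp [Matrix.vecMulVec_apply, mul_comm]

/-- The rank stays constant from `j` to `t` while `ρ` has already jumped. -/
lemma colRank_add_one_le_of_not_isPivot (hC : SchubertSat n j ρ C) (hρ : IsAdmissible r ρ)
    (hjump : ρ (j + 1) = ρ j + 1) {t : ℕ} (hjt : j < t) (ht : t ≤ 2 * r)
    (h : ∀ y : Fin (2 * r), j ≤ y.val → y.val < t → ¬ IsPivot C y) : colRank C t + 1 ≤ ρ t := by
  have h1 : colRank C t = colRank C j :=
    congrArg (fun W : Submodule K (Fin r × Bool → K) => Module.finrank K W)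
      (colSpan_eq_of_not_isPivot hjt.le ht h)
  have h2 := (schubertSat_iff_colRank.1 hC).2.2.1 j (by omega)
  have h3 := hρ.le_of_le (show j + 1 ≤ t from hjt) ht
  omega

/-- Dimension count: vanishing on rows of order `< n` and orthogonality to the columns cost at most
`n + colRank`, leaving a space too large to lie in the column span. -/
lemma exists_dual_of_colRank_lt (h : 2 * colRank C (2 * r) + n < 2 * r) :
    ∃ α v : Fin r × Bool → K, (∀ i, rowOrd i < n → α i = 0) ∧ (∀ y, pairForm (Cᵀ y) α = 0) ∧
      (∀ y, v ⬝ᵥ Cᵀ y = 0) ∧ v ⬝ᵥ α ≠ 0 := by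
  obtain ⟨b, hb, hspan, -⟩ :=
    Submodule.exists_fun_fin_finrank_span_eq K (Cᵀ '' {x | x.val < 2 * r})
  change Submodule.span K (Set.range b) = colSpan C (2 * r) at hspan
  let ψ : (Fin r × Bool → K) →ₗ[K] (({i : Fin r × Bool // rowOrd i < n} → K) ×
      (Fin (colRank C (2 * r)) → K)) :=
    { toFun := fun α => (fun i => α i.1, fun m => pairForm (b m) α)
      map_add' := fun α β => by
        ext m
        · rfl
        · exact pairForm_add_right _ _ _
      map_smul' := fun a α => by
        ext m
        · rfl
        · exact pairForm_smul_right _ _ _ }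
  have hcard : Fintype.card {i : Fin r × Bool // rowOrd i < n} ≤ n := by
    have := Fintype.card_le_of_injective (β := Fin n)
      (fun i : {i : Fin r × Bool // rowOrd i < n} => ⟨rowOrd i.1, i.2⟩)
      (fun i i' hi => Subtype.ext (rowOrd_injective (Fin.mk.inj hi)))
    simpa using this
  have hker : ¬ LinearMap.ker ψ ≤ colSpan C (2 * r) := by
    intro hle
    have h1 := Submodule.finrank_mono hle
    have h2 := LinearMap.finrank_range_add_finrank_ker ψ
    have h3 := Submodule.finrank_le (LinearMap.range ψ)
    rw [Module.finrank_prod, Module.finrank_fintype_fun_eq_card, Module.finrank_fin_fun] at h3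
    rw [Module.finrank_fintype_fun_eq_card, Fintype.card_prod, Fintype.card_fin,
      Fintype.card_bool] at h2
    change _ ≤ colRank C (2 * r) at h1
    omega
  obtain ⟨α, hα, hαC⟩ := SetLike.not_le_iff_exists.1 hker
  rw [LinearMap.mem_ker] at hα
  obtain ⟨f, hf, hle⟩ := Submodule.exists_le_ker_of_notMem hαC
  have hdot : ∀ w, (fun i => f (Pi.single i 1)) ⬝ᵥ w = f w := by
    intro w
    conv_rhs => rw [pi_eq_sum_univ' w]
    simp [dotProduct, mul_comm]
  refine ⟨α, fun i => f (Pi.single i 1), fun i hi => congrFun (congrArg Prod.fst hα) ⟨i, hi⟩,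
    fun y => ?_, fun y => ?_, ?_⟩
  · have hy : Cᵀ y ∈ Submodule.span K (Set.range b) := hspan ▸ col_mem_colSpan y.isLt
    generalize Cᵀ y = u at hy
    induction hy using Submodule.span_induction with
    | mem w hw =>
      obtain ⟨m, rfl⟩ := hw
      exact congrFun (congrArg Prod.snd hα) m
    | zero => simp [pairForm]
    | add u w _ _ hu hw => rw [pairForm_add_left, hu, hw, add_zero]
    | smul a w _ hw => rw [pairForm_smul_left, hw, mul_zero]
  · rw [hdot]; exact hle (col_mem_colSpan y.isLt)
  · rwa [hdot]

/-- Use `B = γ eᵀ` with `e` orthogonal to all rows and starting at `x`. For `γ` take the next pivot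
column, or, if there is none, a vector outside the column span; the bound `hb` leaves room for the
latter. -/
lemma isGoodPoint_of_not_isPivot_rev (hρ : IsAdmissible r ρ) (hn : n < 2 * r)
    (hb : ρ (2 * r) ≤ (2 * r - n + 1) / 2)
    (hjump : ρ (j + 1) = ρ j + 1) (hC : SchubertSat n j ρ C) {x : Fin (2 * r)} (hx : x.val = j)
    (hp : ¬ IsPivot C x) (hpr : ¬ IsPivot C x.rev) : IsGoodPoint k n j ρ ι C := by
  obtain ⟨e, he, hex, hez⟩ := exists_perp hpr
  obtain ⟨-, h2, -, h4⟩ := schubertSat_iff_colRank.1 hC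
  have hrow : ∀ (γ : Fin r × Bool → K) i i',
      γ i' * flagForm (C i) e = γ i * flagForm (C i') e := fun γ i i' => by
    rw [he, he, mul_zero, mul_zero]
  by_cases hq : ∃ q, x < q ∧ IsPivot C q
  · obtain ⟨q, ⟨hxq, hq⟩, hmin⟩ := WellFounded.has_min (wellFounded_lt (α := Fin (2 * r)))
      {q | x < q ∧ IsPivot C q} hq
    obtain ⟨v, hv, hvq⟩ := isPivot_iff.1 hq
    have hnp : ∀ y, x ≤ y → y < q → ¬ IsPivot C y := fun y hxy hyq hy => by
      rcases hxy.lt_or_eq with h | rfl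
      · exact hmin y ⟨h, hy⟩ hyq
      · exact hp hy
    have hdef : IsSchubertDeformation n j ρ C (Matrix.vecMulVec (Cᵀ q) e) := by
      refine isSchubertDeformation_vecMulVec (hrow _) (fun y => h2 y q) (fun t ht => ?_)
        fun i l hil => ?_
      · rcases Nat.lt_or_ge x.val t with h | h
        · rcases Nat.lt_or_ge q.val t with h' | h'
          · exact Or.inr (Or.inl (col_mem_colSpan h'))
          · exact Or.inr (Or.inr (colRank_add_one_le_of_not_isPivot hC hρ hjump (hx ▸ h) ht
              fun y hy hyt => hnp y (by rw [Fin.le_def]; omega) (by rw [Fin.lt_def]; omega)))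
        · exact Or.inl fun l hl => hez l (by rw [Fin.lt_def]; omega)
      · rcases hil with h | ⟨-, h⟩
        · rw [Matrix.transpose_apply, h4 i q (Or.inl h), zero_mul]
        · rw [hez l (by rw [Fin.lt_def]; omega), mul_zero]
    refine hdef.isGoodPoint ι hC hx (fun y hy => hv y (hy.trans_lt hxq)) (fun y hy => ?_) ?_
    · rw [vecMulVec_transpose, hez y hy, zero_smul, dotProduct_zero]
    · rwa [vecMulVec_transpose, hex, one_smul]
  · push Not at hq
    have hroom : ∀ t, j < t → t ≤ 2 * r → colRank C t + 1 ≤ ρ t := fun t hjt ht =>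
      colRank_add_one_le_of_not_isPivot hC hρ hjump hjt ht fun y hy _ => by
        rcases (show x ≤ y by rw [Fin.le_def]; omega).lt_or_eq with h | rfl
        · exact hq y h
        · exact hp
    have := hroom (2 * r) (hx ▸ x.isLt) le_rfl
    obtain ⟨α, v, hα, hαC, hv, hvα⟩ := exists_dual_of_colRank_lt (C := C) (n := n) (by omega)
    have hdef : IsSchubertDeformation n j ρ C (Matrix.vecMulVec α e) := by
      refine isSchubertDeformation_vecMulVec (hrow _) hαC (fun t ht => ?_) fun i l hil => ?_
      · rcases Nat.lt_or_ge x.val t with h | h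
        · exact Or.inr (Or.inr (hroom t (hx ▸ h) ht))
        · exact Or.inl fun l hl => hez l (by rw [Fin.lt_def]; omega)
      · rcases hil with h | ⟨-, h⟩
        · rw [hα i h, zero_mul]
        · rw [hez l (by rw [Fin.lt_def]; omega), mul_zero]
    refine hdef.isGoodPoint ι hC hx (fun y _ => hv y) (fun y hy => ?_) ?_
    · rw [vecMulVec_transpose, hez y hy, zero_smul, dotProduct_zero]
    · rwa [vecMulVec_transpose, hex, one_smul]

end cases

section cases
variable {k : Type*} [Field k] {r n j : ℕ} {ρ : ℕ → ℕ} {K : Type*} [Field K] (ι : k →+* K)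
  {C B : Matrix (Fin r × Bool) (Fin (2 * r)) K}

lemma IsAdmissible.le_add {r : ℕ} {ρ : ℕ → ℕ} (h : IsAdmissible r ρ) {s t : ℕ} (hst : s ≤ t)
    (ht : t ≤ 2 * r) : ρ t ≤ ρ s + (t - s) := by
  induction t, hst using Nat.le_induction with
  | base => simp
  | succ t hst ih =>
    have := ih (by omega)
    have := h.step t (by omega)
    omega

/-- From `t` to `h + 1` the rank grows at every step, whereas `ρ` misses the last one; the bound at
`h + 1` then forces slack at `t`. -/
lemma colRank_add_one_le_of_isPivot (hC : SchubertSat n j ρ C) (hρ : IsAdmissible r ρ)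
    {h : Fin (2 * r)} (hjump : ρ (h.val + 1) = ρ h.val) {t : ℕ} (ht : t ≤ h.val)
    (hp : ∀ y : Fin (2 * r), t ≤ y.val → y ≤ h → IsPivot C y) : colRank C t + 1 ≤ ρ t := by
  have hh := h.isLt
  have h1 := colRank_eq_of_isPivot (C := C) (show t ≤ h.val + 1 by omega) (by omega)
    fun y hty hyh => hp y hty (by rw [Fin.le_def]; omega)
  have h2 := (schubertSat_iff_colRank.1 hC).2.2.1 (h.val + 1) (by omega)
  have h3 := hρ.le_add ht hh.le
  omega

/-- Column `z` was dependent on earlier columns, which do not change; after adding `τ` times column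
`h` to it, column `h` is in the span of the columns before `h`. -/
lemma not_isPivot_add_smul_vecMulVec {e : Fin (2 * r) → K} {τ : K} (hτ : τ ≠ 0)
    {z h : Fin (2 * r)} (hzh : z < h) (hez : e z = 1) (he : ∀ y < z, e y = 0)
    (hz : ¬ IsPivot C z) : ¬ IsPivot (C + τ • Matrix.vecMulVec (Cᵀ h) e) h := by
  set D := C + τ • Matrix.vecMulVec (Cᵀ h) e
  have hD : ∀ y, Dᵀ y = Cᵀ y + (τ * e y) • Cᵀ h := fun y => by
    ext i; simp [D, Matrix.vecMulVec_apply]; ring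
  have h1 : Cᵀ z ∈ colSpan D h.val := by
    refine (colSpan_le fun y hy => ?_ : colSpan C z.val ≤ colSpan D h.val) (not_not.1 hz)
    have h2 : Cᵀ y = Dᵀ y := by rw [hD, he y hy, mul_zero, zero_smul, add_zero]
    rw [h2]
    exact col_mem_colSpan (hy.trans hzh)
  have h3 : Cᵀ h ∈ colSpan D h.val := by
    have h4 : Cᵀ h = τ⁻¹ • (Dᵀ z - Cᵀ z) := by
      rw [hD, hez, mul_one, add_sub_cancel_left, smul_smul, inv_mul_cancel₀ hτ, one_smul]
    rw [h4]
    exact Submodule.smul_mem _ _ (Submodule.sub_mem _ (col_mem_colSpan hzh) h1)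
  rw [IsPivot, not_not, hD]
  exact Submodule.add_mem _ h3 (Submodule.smul_mem _ _ h3)

/-- The sign `flagSign K x * flagSign K z` makes the pairing of row `i` of `C` with row `i'` of `B`
symmetric in `i` and `i'`. Columns of `B` are combinations of columns of `C`, so column isotropy is
clear. -/
lemma isSchubertDeformation_pair (hC : SchubertSat n j ρ C) {x z : Fin (2 * r)} (hx : x.val = j)
    (hzx : z.rev ≠ x) (hzero : ∀ i, rowOrd i = n → z.val < j → C i x.rev = 0)
    (hrank : ∀ t ≤ 2 * r, (x.val < t → Cᵀ z.rev ∈ colSpan C t) ∧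
        (z.val < t → Cᵀ x.rev ∈ colSpan C t) ∨ colRank C t + 1 ≤ ρ t ∧
        ((x.val < t → Cᵀ z.rev ∈ colSpan C t) ∨ (z.val < t → Cᵀ x.rev ∈ colSpan C t))) :
    IsSchubertDeformation n j ρ C (Matrix.vecMulVec (Cᵀ z.rev) (Pi.single x 1) +
      Matrix.vecMulVec (Cᵀ x.rev) ((flagSign K x * flagSign K z) • Pi.single z 1)) := by
  obtain ⟨-, h2, -, h4⟩ := schubertSat_iff_colRank.1 hC
  set c := flagSign K x * flagSign K z
  set B := Matrix.vecMulVec (Cᵀ z.rev) (Pi.single x 1) +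
      Matrix.vecMulVec (Cᵀ x.rev) (c • Pi.single z 1)
  have hr : ∀ i, B i = C i z.rev • Pi.single x 1 + (C i x.rev * c) • Pi.single z 1 := fun i => by
    ext l; simp [B, Matrix.vecMulVec_apply]; ring
  have hc : ∀ l, Bᵀ l = (Pi.single x 1 : Fin (2 * r) → K) l • Cᵀ z.rev +
      (c * (Pi.single z 1 : Fin (2 * r) → K) l) • Cᵀ x.rev := fun l => by
    ext i; simp [B, Matrix.vecMulVec_apply]; ring
  have hxz : (Pi.single x 1 : Fin (2 * r) → K) z.rev = 0 := Pi.single_eq_of_ne hzx _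
  have hzx' : (Pi.single z 1 : Fin (2 * r) → K) x.rev = 0 :=
    Pi.single_eq_of_ne (fun h => hzx (by rw [← h, Fin.rev_rev])) _
  have hxx : (Pi.single x 1 : Fin (2 * r) → K) x.rev = 0 := Pi.single_eq_of_ne (rev_ne_self x) _
  have hzz : (Pi.single z 1 : Fin (2 * r) → K) z.rev = 0 := Pi.single_eq_of_ne (rev_ne_self z) _
  constructor
  · intro i i'
    simp only [hr, flagForm_add_right, flagForm_smul_right, flagForm_single_right, c]
    linear_combination (flagSign K x * (C i' z.rev * C i x.rev - C i z.rev * C i' x.rev)) *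
      flagSign_mul_self (A := K) z
  · intro i i'
    simp only [hr, flagForm_add_right, flagForm_smul_right,
      flagForm_single_right, Pi.add_apply, Pi.smul_apply, smul_eq_mul, hxz, hzx', hxx, hzz, mul_zero,
      neg_zero, add_zero]
  · intro l l'
    simp only [hc, pairForm_add_right, pairForm_smul_right, h2, mul_zero, add_zero]
  · intro l l'
    simp only [hc, pairForm_add_left, pairForm_smul_left, pairForm_add_right, pairForm_smul_right,
      h2, mul_zero, add_zero]
  · intro t ht
    have hx' : ∀ l : Fin (2 * r), l.val < t → (x.val < t → Cᵀ z.rev ∈ colSpan C t) →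
        (Pi.single x 1 : Fin (2 * r) → K) l • Cᵀ z.rev ∈ colSpan C t := by
      intro l hl h
      by_cases hlx : l = x
      · exact Submodule.smul_mem _ _ (h (hlx ▸ hl))
      · rw [Pi.single_eq_of_ne hlx, zero_smul]; exact Submodule.zero_mem _
    have hz' : ∀ l : Fin (2 * r), l.val < t → (z.val < t → Cᵀ x.rev ∈ colSpan C t) →
        (c * (Pi.single z 1 : Fin (2 * r) → K) l) • Cᵀ x.rev ∈ colSpan C t := by
      intro l hl h
      by_cases hlz : l = z
      · exact Submodule.smul_mem _ _ (h (hlz ▸ hl))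
      · rw [Pi.single_eq_of_ne hlz, mul_zero, zero_smul]; exact Submodule.zero_mem _
    rcases hrank t ht with ⟨h5, h6⟩ | ⟨h5, h6 | h6⟩
    · exact Or.inl fun l hl => by
        rw [hc]; exact Submodule.add_mem _ (hx' l hl h5) (hz' l hl h6)
    · refine Or.inr ⟨h5, Cᵀ x.rev, fun l hl => ⟨-(c * (Pi.single z 1 : Fin (2 * r) → K) l), ?_⟩⟩
      rw [hc, neg_smul, add_neg_cancel_right]
      exact hx' l hl h6
    · refine Or.inr ⟨h5, Cᵀ z.rev, fun l hl => ⟨-(Pi.single x 1 : Fin (2 * r) → K) l, ?_⟩⟩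
      rw [hc, neg_smul, add_comm, neg_add_cancel_left]
      exact hz' l hl h6
  · intro i l hil
    rw [hr, Pi.add_apply, Pi.smul_apply, Pi.smul_apply, smul_eq_mul, smul_eq_mul]
    rcases hil with h | ⟨h, h'⟩
    · rw [h4 i _ (Or.inl h), h4 i _ (Or.inl h)]; simp
    · have hlx : l ≠ x := by rintro rfl; omega
      by_cases hlz : l = z
      · rw [hzero i h (hlz ▸ h'), Pi.single_eq_of_ne hlx]; simp
      · rw [Pi.single_eq_of_ne hlx, Pi.single_eq_of_ne hlz]; simp

-- Let `z` be the last non-pivot before `x.rev`. As `ρ` is flat at `x.rev`, there is slack in the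
-- rank bounds between `z` and `x.rev`, which allows column `x.rev` to be added to earlier columns.
open Polynomial in
lemma isGoodPoint_of_isPivot_rev (hρ : IsAdmissible r ρ) (hn : n < 2 * r)
    (hb : ρ (2 * r) ≤ (2 * r - n + 1) / 2)
    (hjump : ρ (j + 1) = ρ j + 1) (hC : SchubertSat n j ρ C) {x : Fin (2 * r)} (hx : x.val = j)
    (hp : ¬ IsPivot C x) (hpr : IsPivot C x.rev) : IsGoodPoint k n j ρ ι C := by
  obtain ⟨h1, h2, h3, h4⟩ := schubertSat_iff_colRank.1 hC
  have hxr : x.rev.val = 2 * r - 1 - j := by rw [Fin.val_rev]; omega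
  have hxlt := x.isLt
  have hflat : ρ (x.rev.val + 1) = ρ x.rev.val := by
    rcases hρ.pair j (by omega) with h | h
    · omega
    · rwa [hxr]
  have hex : ∃ z, z < x.rev ∧ ¬ IsPivot C z := by
    by_contra hall
    push Not at hall
    have := colRank_add_one_le_of_isPivot hC hρ hflat (Nat.zero_le _) fun y _ hy => by
      rcases hy.lt_or_eq with h | rfl
      · exact hall y h
      · exact hpr
    rw [hρ.zero] at this
    omega
  obtain ⟨z, ⟨hzh, hz⟩, hmax⟩ := WellFounded.has_min (wellFounded_gt (α := Fin (2 * r)))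
      {z | z < x.rev ∧ ¬ IsPivot C z} hex
  have hpiv : ∀ y, z < y → y ≤ x.rev → IsPivot C y := fun y hzy hy => by
    rcases hy.lt_or_eq with h | rfl
    · by_contra hy'; exact hmax y ⟨h, hy'⟩ hzy
    · exact hpr
  have hroom : ∀ t, z.val < t → t ≤ x.rev.val → colRank C t + 1 ≤ ρ t := fun t hzt hth =>
    colRank_add_one_le_of_isPivot hC hρ hflat hth fun y hty hy =>
      hpiv y (by rw [Fin.lt_def]; omega) hy
  -- If `x` precedes its mirror, it is itself a non-pivot before `x.rev`, hence at most `z`.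
  have hxz : x.rev < x ∨ x ≤ z := by
    rcases lt_trichotomy x.rev x with h | h | h
    · exact Or.inl h
    · exact absurd h (rev_ne_self x)
    · exact Or.inr (not_lt.1 fun h' => hmax x ⟨h, hp⟩ h')
  have hzero : ∀ i, rowOrd i = n → z.val < j → C i x.rev = 0 := fun i hi hzj =>
    h4 i _ (Or.inr ⟨hi, by rcases hxz with h | h <;> simp only [Fin.lt_def, Fin.le_def] at h <;>
      omega⟩)
  by_cases hzr : IsPivot C z.rev
  · have hxq : x < z.rev := by rw [← Fin.rev_lt_rev, Fin.rev_rev]; exact hzh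
    -- Mirroring the pivots between `z` and `x.rev` gives non-pivots, hence slack between `x` and
    -- `z.rev` too.
    have hnp : ∀ y, x ≤ y → y < z.rev → ¬ IsPivot C y := by
      intro y hxy hyz
      rcases hxy.lt_or_eq with h | rfl
      · have := not_isPivot_rev h1 (hpiv y.rev (by rw [← Fin.rev_lt_rev, Fin.rev_rev]; exact hyz)
          (Fin.rev_le_rev.2 h.le))
        rwa [Fin.rev_rev] at this
      · exact hp
    have hroom' : ∀ t, x.val < t → t ≤ z.rev.val → colRank C t + 1 ≤ ρ t := fun t hxt htz =>
      colRank_add_one_le_of_not_isPivot hC hρ hjump (hx ▸ hxt) (by have := z.rev.isLt; omega)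
        fun y hy hyt => hnp y (by rw [Fin.le_def]; omega) (by rw [Fin.lt_def]; omega)
    -- Here the two ranges of slack cover all `t` with `x < t ≤ x.rev`, so column `x.rev` can be
    -- added to column `x` directly. Otherwise columns `z.rev` and `x.rev` are added to columns `x`
    -- and `z` together.
    by_cases hcov : x < x.rev ∧ z < z.rev
    · obtain ⟨v, hv, hvh⟩ := isPivot_iff.1 hpr
      have hdef : IsSchubertDeformation n j ρ C
          (Matrix.vecMulVec (Cᵀ x.rev) (Pi.single x 1)) := by
        refine isSchubertDeformation_vecMulVec (fun i i' => ?_) (fun y => h2 y _) (fun t ht => ?_)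
          fun i l hil => ?_
        · rw [flagForm_single_right, flagForm_single_right, Matrix.transpose_apply,
            Matrix.transpose_apply]
          ring
        · rcases Nat.lt_or_ge x.val t with h | h
          · refine Or.inr ?_
            rcases Nat.lt_or_ge x.rev.val t with h' | h'
            · exact Or.inl (col_mem_colSpan h')
            · rcases Nat.lt_or_ge z.val t with h'' | h''
              · exact Or.inr (hroom t h'' h')
              · exact Or.inr (hroom' t h (h''.trans hcov.2.le))
          · exact Or.inl fun l hl => Pi.single_eq_of_ne (by rintro rfl; omega) _
        · rcases hil with h | ⟨-, h⟩
          · rw [Matrix.transpose_apply, h4 i _ (Or.inl h), zero_mul]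
          · rw [Pi.single_eq_of_ne (by rintro rfl; omega), mul_zero]
      refine hdef.isGoodPoint ι hC hx (fun y hy => hv y (hy.trans_lt hcov.1)) (fun y hy => ?_) ?_
      · rw [vecMulVec_transpose, Pi.single_eq_of_ne hy.ne, zero_smul, dotProduct_zero]
      · rwa [vecMulVec_transpose, Pi.single_eq_same, one_smul]
    · obtain ⟨v, hv, hvq⟩ := isPivot_iff.1 hzr
      have hord : x.rev < x ∨ z.rev < z := by
        by_contra hno
        push Not at hno
        exact hcov ⟨lt_of_le_of_ne hno.1 (rev_ne_self x).symm,
          lt_of_le_of_ne hno.2 (rev_ne_self z).symm⟩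
      have hdef := isSchubertDeformation_pair hC hx hxq.ne' hzero (fun t ht => by
        by_cases hxt : x.val < t → Cᵀ z.rev ∈ colSpan C t
        · by_cases hzt : z.val < t → Cᵀ x.rev ∈ colSpan C t
          · exact Or.inl ⟨hxt, hzt⟩
          · push Not at hzt
            refine Or.inr ⟨hroom t hzt.1 (not_lt.1 fun h => hzt.2 (col_mem_colSpan h)),
              Or.inl hxt⟩
        · push Not at hxt
          have htz : t ≤ z.rev.val := not_lt.1 fun h => hxt.2 (col_mem_colSpan h)
          refine Or.inr ⟨hroom' t hxt.1 htz, Or.inr fun hzt => ?_⟩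
          rcases hord with h | h
          · exact col_mem_colSpan (lt_trans h hxt.1)
          · exact absurd (hzt.trans_le htz) (not_lt.2 (Fin.lt_def.1 h).le))
      have hxz' : x ≠ z := by
        rintro rfl
        rcases hord with h | h <;> exact absurd (h.trans hxq) (lt_irrefl _)
      have hB : ∀ l, (Matrix.vecMulVec (Cᵀ z.rev) (Pi.single x 1) +
          Matrix.vecMulVec (Cᵀ x.rev) ((flagSign K x * flagSign K z) • Pi.single z 1))ᵀ l =
          (Pi.single x 1 : Fin (2 * r) → K) l • Cᵀ z.rev +
          ((flagSign K x * flagSign K z) * (Pi.single z 1 : Fin (2 * r) → K) l) • Cᵀ x.rev := by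
        intro l
        ext i; simp [Matrix.vecMulVec_apply]; ring
      refine hdef.isGoodPoint ι hC hx (fun y hy => hv y (hy.trans_lt hxq)) (fun y hy => ?_) ?_
      · rw [hB, Pi.single_eq_of_ne hy.ne, zero_smul, zero_add]
        by_cases hyz : y = z
        · subst hyz
          rw [dotProduct_smul, hv x.rev, smul_zero]
          rcases hxz with h | h
          · exact h.trans hxq
          · exact absurd hy (not_lt.2 h)
        · rw [Pi.single_eq_of_ne hyz, mul_zero, zero_smul, dotProduct_zero]
      · rw [hB, Pi.single_eq_same, one_smul, Pi.single_eq_of_ne hxz', mul_zero, zero_smul,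
          add_zero]
        exact hvq
  -- Adding column `x.rev` along `e` destroys the pivot at `x.rev`, which leads back to the cases
  -- already settled.
  · obtain ⟨e, he, hez, hezero⟩ := exists_perp hzr
    have hdef : IsSchubertDeformation n j ρ C (Matrix.vecMulVec (Cᵀ x.rev) e) := by
      refine isSchubertDeformation_vecMulVec (fun i i' => by rw [he, he, mul_zero, mul_zero])
        (fun y => h2 y _) (fun t ht => ?_) fun i l hil => ?_
      · rcases Nat.lt_or_ge z.val t with h | h
        · rcases Nat.lt_or_ge x.rev.val t with h' | h'
          · exact Or.inr (Or.inl (col_mem_colSpan h'))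
          · exact Or.inr (Or.inr (hroom t h h'))
        · exact Or.inl fun l hl => hezero l (by rw [Fin.lt_def]; omega)
      · rcases hil with h | ⟨h, h'⟩
        · rw [Matrix.transpose_apply, h4 i _ (Or.inl h), zero_mul]
        · rcases lt_or_ge l z with hl | hl
          · rw [hezero l hl, mul_zero]
          · rw [Matrix.transpose_apply, hzero i h (lt_of_le_of_lt hl h'), zero_mul]
    refine isGoodPoint_of_deformation ι C (Matrix.vecMulVec (Cᵀ x.rev) e) ?_
    set φ := algebraMap K (FractionRing K[X])
    set τ := algebraMap K[X] (FractionRing K[X]) X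
    have hτ : τ ≠ 0 := by simp [τ]
    have hD := (hdef.map φ).schubertSat (hC.map φ) τ
    have hnp : ¬ IsPivot (C.map φ + τ • (Matrix.vecMulVec (Cᵀ x.rev) e).map φ) x.rev := by
      have := not_isPivot_add_smul_vecMulVec (C := C.map φ) (e := fun l => φ (e l)) hτ hzh
        (by rw [hez, map_one]) (fun y hy => by rw [hezero y hy, map_zero]) (not_isPivot_map φ hz)
      convert this using 3
      ext i l
      simp [Matrix.vecMulVec_apply]
    by_cases hpx : IsPivot (C.map φ + τ • (Matrix.vecMulVec (Cᵀ x.rev) e).map φ) x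
    · exact isGoodPoint_of_isPivot _ hD hx hpx
    · exact isGoodPoint_of_not_isPivot_rev _ hρ hn hb hjump hD hx hpx hnp

theorem isGoodPoint_of_jump (hn : n < 2 * r) (hj : j < 2 * r)
    (hρ : IsAdmissible r ρ) (hb : ρ (2 * r) ≤ (2 * r - n + 1) / 2) (hjump : ρ (j + 1) = ρ j + 1)
    (hC : SchubertSat n j ρ C) : IsGoodPoint k n j ρ ι C := by
  by_cases hp : IsPivot C ⟨j, hj⟩
  · exact isGoodPoint_of_isPivot ι hC rfl hp
  · by_cases hpr : IsPivot C (Fin.rev ⟨j, hj⟩)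
    · exact isGoodPoint_of_isPivot_rev ι hρ hn hb hjump hC rfl hp hpr
    · exact isGoodPoint_of_not_isPivot_rev ι hρ hn hb hjump hC rfl hp hpr

end cases

/-! ### The induction. -/

section main
variable {k : Type*} [Field k] {r n j : ℕ} {ρ : ℕ → ℕ}

/-- A non-zero-divisor statement modulo the radical. -/
lemma mem_radical_of_X_mul_mem (hn : n < 2 * r) (hj : j < 2 * r) (hρ : IsAdmissible r ρ)
    (hb : ρ (2 * r) ≤ (2 * r - n + 1) / 2) (hjump : ρ (j + 1) = ρ j + 1)
    {i₀ : Fin r × Bool} (hi₀ : rowOrd i₀ = n)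
    {g : MvPolynomial ((Fin r × Bool) × Fin (2 * r)) k}
    (hg : MvPolynomial.X (i₀, ⟨j, hj⟩) * g ∈ (schubertIdeal k r n j ρ).radical) :
    g ∈ (schubertIdeal k r n j ρ).radical := by
  rw [Ideal.radical_eq_sInf, Submodule.mem_sInf]
  rintro P ⟨hIP, hP⟩
  -- The radical is the intersection of the primes `P` above the ideal; membership in `P` is tested
  -- at the generic point, with values in the fraction field of `S ⧸ P`.
  let S := MvPolynomial ((Fin r × Bool) × Fin (2 * r)) k
  let φ : S →+* FractionRing (S ⧸ P) :=
    (algebraMap (S ⧸ P) (FractionRing (S ⧸ P))).comp (Ideal.Quotient.mk P)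
  have hφ : φ = MvPolynomial.eval₂Hom (φ.comp MvPolynomial.C)
      (fun p => (genericM k r).map φ p.1 p.2) :=
    MvPolynomial.ringHom_ext (fun a => by simp) fun p => by simp
  have hS : SchubertSat n j ρ ((genericM k r).map φ) :=
    (schubertSat_quotient k hIP).map (algebraMap (S ⧸ P) (FractionRing (S ⧸ P)))
  have h0 := isGoodPoint_of_jump (φ.comp MvPolynomial.C) hn hj hρ hb hjump hS i₀ ⟨j, hj⟩ hi₀ rfl
    g hg
  rw [← hφ] at h0
  rw [← Ideal.Quotient.eq_zero_iff_mem]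
  exact IsFractionRing.injective (S ⧸ P) (FractionRing (S ⧸ P)) (by rw [map_zero]; exact h0)

lemma schubertIdeal_succ (hj : j < 2 * r) {i₀ : Fin r × Bool} (hi₀ : rowOrd i₀ = n) :
    schubertIdeal k r n (j + 1) ρ =
      schubertIdeal k r n j ρ ⊔ Ideal.span {MvPolynomial.X (i₀, ⟨j, hj⟩)} := by
  apply le_antisymm
  · rw [schubertIdeal_le_iff]
    obtain ⟨h1, h2, h3, h4⟩ := schubertSat_iff.1 (schubertSat_quotient k (le_sup_left :
      schubertIdeal k r n j ρ ≤ schubertIdeal k r n j ρ ⊔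
        Ideal.span {MvPolynomial.X (i₀, ⟨j, hj⟩)}))
    refine schubertSat_iff.2 ⟨h1, h2, h3, fun i x h => ?_⟩
    by_cases h5 : rowOrd i < n ∨ rowOrd i = n ∧ x.val < j
    · exact h4 i x h5
    · have hi : i = i₀ := rowOrd_injective (by omega)
      have hx : x = ⟨j, hj⟩ := Fin.ext (by simp only; omega)
      subst hi hx
      exact Ideal.Quotient.eq_zero_iff_mem.2
        (Ideal.mem_sup_right (Ideal.mem_span_singleton_self _))
  · obtain ⟨h1, h2, h3, h4⟩ := schubertSat_iff.1 (schubertSat_quotient k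
      (le_refl (schubertIdeal k r n (j + 1) ρ)))
    refine sup_le ?_ ?_
    · rw [schubertIdeal_le_iff]
      exact schubertSat_iff.2 ⟨h1, h2, h3, fun i x h => h4 i x (by omega)⟩
    · rw [Ideal.span_le, Set.singleton_subset_iff]
      exact Ideal.Quotient.eq_zero_iff_mem.1 (h4 i₀ ⟨j, hj⟩ (Or.inr ⟨hi₀, Nat.lt_succ_self j⟩))

/-- The inductive step in the column index. -/
lemma isRadical_schubertIdeal_step (hn : n < 2 * r) (hj : j < 2 * r)
    (ih : ∀ ρ, IsAdmissible r ρ → ρ (2 * r) ≤ (2 * r - n + 1) / 2 →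
      (schubertIdeal k r n (j + 1) ρ).IsRadical)
    (hρ : IsAdmissible r ρ) (hb : ρ (2 * r) ≤ (2 * r - n + 1) / 2) :
    (schubertIdeal k r n j ρ).IsRadical := by
  obtain ⟨i₀, hi₀⟩ := exists_rowOrd_eq hn
  have hjumpcase : ∀ ρ, IsAdmissible r ρ → ρ (2 * r) ≤ (2 * r - n + 1) / 2 →
      ρ (j + 1) = ρ j + 1 → (schubertIdeal k r n j ρ).IsRadical := by
    intro ρ hρ hb hjump
    refine isRadical_of_nonZeroDivisor schubertIdeal_isHomogeneous (i₀, ⟨j, hj⟩) ?_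
      fun g hg => mem_radical_of_X_mul_mem hn hj hρ hb hjump hi₀ hg
    rw [← schubertIdeal_succ hj hi₀]
    exact ih ρ hρ hb
  rcases hρ.step j hj with hjump | hjump
  swap
  · exact hjumpcase ρ hρ hb hjump
  have hS := schubertSat_quotient k (le_refl (schubertIdeal k r n j ρ))
  rcases Nat.eq_zero_or_pos (ρ (j + 1)) with h0 | hpos
  · have hx : MvPolynomial.X (i₀, ⟨j, hj⟩) ∈ schubertIdeal k r n j ρ := by
      have := hS.mul_det_eq_zero_of_le hi₀ hj (t := 0) (Nat.zero_le _) h0 Fin.elim0 Fin.elim0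
        (fun i => i.elim0)
      rw [Matrix.det_isEmpty, mul_one] at this
      exact Ideal.Quotient.eq_zero_iff_mem.1 this
    have := ih ρ hρ hb
    rwa [schubertIdeal_succ hj hi₀, sup_eq_left.2 ((Ideal.span_singleton_le_iff_mem _).2 hx)]
      at this
  obtain ⟨ρ', hρ', hjump', hval⟩ := hρ.exists_insert hj hjump hpos
  have hle : ∀ t ≤ 2 * r, ρ' t ≤ ρ t := fun t ht => by have := hval t ht; omega
  have hJ := hjumpcase ρ' hρ' ((hle _ le_rfl).trans hb) hjump'
  have hS' := schubertSat_quotient k (le_refl (schubertIdeal k r n j ρ'))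
  refine isRadical_of_mul_le hJ ?_ (MvPolynomial.X (i₀, ⟨j, hj⟩)) ?_ ?_ ?_
  · rw [schubertIdeal_le_iff]
    obtain ⟨h1, h2, h3, h4⟩ := schubertSat_iff.1 hS'
    exact schubertSat_iff.2 ⟨h1, h2, fun t ht f g hg => det_submatrix_eq_zero_of_le _
      (fun k => k.val < t) (Nat.succ_le_succ (hle t ht)) (h3 t ht) f g hg, h4⟩
  · rw [← schubertIdeal_succ hj hi₀]
    exact ih ρ hρ hb
  · intro g hg
    let I := schubertIdeal k r n j ρ
    -- Only the minors differ between the two ideals, and `hval` sorts them into unchanged bounds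
    -- and the two cases of vanishing products.
    have hcolon : schubertIdeal k r n j ρ' ≤ I.colon {MvPolynomial.X (i₀, ⟨j, hj⟩)} := by
      rw [schubertIdeal, Ideal.span_le]
      intro p hp
      rw [SetLike.mem_coe, Submodule.mem_colon_singleton, smul_eq_mul]
      have hmem : ∀ {p}, SchubertGen n j ρ (genericM k r) p →
          p * MvPolynomial.X (i₀, ⟨j, hj⟩) ∈ I := fun hp =>
        I.mul_mem_right _ (Ideal.subset_span hp)
      rcases hp with ⟨i, i'⟩ | ⟨x, y⟩ | ⟨t, ht, f, g, hg⟩ | ⟨i, x, h⟩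
      · exact hmem (.row i i')
      · exact hmem (.col x y)
      · have hdet : ∀ l (f : Fin l → Fin r × Bool) (g : Fin l → Fin (2 * r)),
            Ideal.Quotient.mk I ((genericM k r).submatrix f g).det =
            (((genericM k r).map (Ideal.Quotient.mk I)).submatrix f g).det := fun l f g => by
          rw [RingHom.map_det]; rfl
        rw [mul_comm (Matrix.det _), ← Ideal.Quotient.eq_zero_iff_mem, map_mul, hdet]
        rcases hval t ht with h | ⟨h, ⟨h5, h6⟩ | ⟨h5, h6⟩⟩
        · rw [(schubertSat_iff.1 hS).2.2.1 t ht |> fun h3 => det_submatrix_eq_zero_of_le _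
            (fun k => k.val < t) (by rw [h]) h3 f g hg, mul_zero]
        · exact hS.mul_det_eq_zero_of_le hi₀ hj h5 (by omega) f g hg
        · exact hS.mul_det_eq_zero_of_gt hi₀ hj h5 ht h6 h.symm f g hg
      · exact hmem (.zero i x h)
    have := hcolon hg
    rwa [Submodule.mem_colon_singleton, smul_eq_mul, mul_comm g] at this
  · intro g hg
    exact hJ (mem_radical_of_X_mul_mem hn hj hρ' ((hle _ le_rfl).trans hb) hjump' hi₀
      (Ideal.le_radical hg))

lemma schubertIdeal_next_row (hn : n < 2 * r) (hρ : ∀ t ≤ 2 * r, ρ t ≤ (2 * r - n + 1) / 2) :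
    schubertIdeal k r n (2 * r) ρ =
      schubertIdeal k r (n + 1) 0 (fun t => min (ρ t) ((2 * r - n) / 2)) := by
  refine le_antisymm ?_ ?_
  · rw [schubertIdeal_le_iff, schubertSat_next_row_iff hn hρ]
    exact schubertSat_quotient k le_rfl
  · rw [schubertIdeal_le_iff, ← schubertSat_next_row_iff hn hρ]
    exact schubertSat_quotient k le_rfl

/-- All variables are in the ideal, so it is the kernel of evaluation at the zero matrix. -/
lemma isRadical_schubertIdeal_top (k : Type*) [Field k] (j : ℕ) (ρ : ℕ → ℕ) :
    (schubertIdeal k r (2 * r) j ρ).IsRadical := by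
  let φ : MvPolynomial ((Fin r × Bool) × Fin (2 * r)) k →+* k :=
    MvPolynomial.eval₂Hom (RingHom.id k) fun p => (0 : Matrix (Fin r × Bool) (Fin (2 * r)) k) p.1 p.2
  have h1 : schubertIdeal k r (2 * r) j ρ = RingHom.ker φ := by
    refine le_antisymm ?_ ?_
    · rw [schubertIdeal_le_ker_iff, genericM_map_eval₂Hom, schubertSat_iff]
      refine ⟨fun _ _ => by simp [flagForm], fun _ _ => by simp [pairForm], fun t _ f g _ => ?_,
        fun _ _ _ => rfl⟩
      exact Matrix.det_eq_zero_of_row_eq_zero 0 fun _ => rfl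
    · intro p hp
      rw [← Ideal.Quotient.eq_zero_iff_mem]
      have h4 := (schubertSat_iff.1
        (schubertSat_quotient k (le_refl (schubertIdeal k r (2 * r) j ρ)))).2.2.2
      have : Ideal.Quotient.mk (schubertIdeal k r (2 * r) j ρ) =
          ((Ideal.Quotient.mk (schubertIdeal k r (2 * r) j ρ)).comp MvPolynomial.C).comp φ := by
        refine MvPolynomial.ringHom_ext (fun a => by simp [φ]) fun p => ?_
        have := h4 p.1 p.2 (Or.inl (rowOrd_lt _))
        simpa [φ] using this
      rw [this, RingHom.comp_apply, hp, map_zero]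
  rw [h1]
  exact (RingHom.ker_isPrime φ).isRadical

/-- All the ideals `schubertIdeal` of admissible rank functions are radical. -/
theorem isRadical_schubertIdeal (k : Type*) [Field k] {n j : ℕ} (hn : n ≤ 2 * r) (hj : j ≤ 2 * r)
    (hρ : IsAdmissible r ρ) (hb : ρ (2 * r) ≤ (2 * r - n + 1) / 2) :
    (schubertIdeal k r n j ρ).IsRadical := by
  induction hn using Nat.decreasingInduction generalizing j ρ with
  | self => exact isRadical_schubertIdeal_top k j ρ
  | of_succ n hn ihn =>
    induction hj using Nat.decreasingInduction generalizing ρ with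
    | self =>
      rw [schubertIdeal_next_row hn fun t ht => (hρ.le_of_le ht le_rfl).trans hb]
      refine ihn (Nat.zero_le _) (hρ.min _) ((min_le_right _ _).trans ?_)
      omega
    | of_succ j hj ihj =>
      exact isRadical_schubertIdeal_step hn hj (fun ρ h1 h2 => ihj h1 h2) hρ hb

end main

/-! ### Return to the original ideal. -/

section transfer
variable {r : ℕ}

/-- Rows of a `2r × 2r` matrix, grouped in hyperbolic pairs. -/
def rowEquiv (r : ℕ) : Fin r ⊕ Fin r ≃ Fin r × Bool where
  toFun := Sum.elim (fun i => (i, false)) (fun i => (i.rev, true))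
  invFun p := if p.2 then Sum.inr p.1.rev else Sum.inl p.1
  left_inv := by rintro (i | i) <;> simp
  right_inv := by rintro ⟨i, _ | _⟩ <;> simp

/-- Columns of a `2r × 2r` matrix, in their natural order. -/
def colEquiv (r : ℕ) : Fin r ⊕ Fin r ≃ Fin (2 * r) :=
  finSumFinEquiv.trans (finCongr (two_mul r).symm)

lemma rev_colEquiv_inl (i : Fin r) : (colEquiv r (Sum.inl i)).rev = colEquiv r (Sum.inr i.rev) := by
  ext
  have := i.isLt
  simp [colEquiv, Fin.val_rev]; omega

lemma rev_colEquiv_inr (i : Fin r) : (colEquiv r (Sum.inr i)).rev = colEquiv r (Sum.inl i.rev) := by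
  have := rev_colEquiv_inl i.rev
  rw [Fin.rev_rev] at this
  rw [← this, Fin.rev_rev]

variable {A : Type*} [CommRing A]

lemma sum_sympJ_mul (u v : Fin r ⊕ Fin r → A) :
    ∑ x, (∑ y, u y * sympJ r A y x) * v x =
      ∑ i, (u (Sum.inl i) * v (Sum.inr i.rev) - u (Sum.inr i.rev) * v (Sum.inl i)) := by
  have h1 : ∀ i x : Fin r, (x = i.rev) = (i = x.rev) := fun i x => by
    rw [eq_iff_iff]
    constructor <;> (rintro rfl; rw [Fin.rev_rev])
  simp only [Fintype.sum_sum_type, sympJ, Matrix.fromBlocks_apply₁₁, Matrix.fromBlocks_apply₁₂,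
    Matrix.fromBlocks_apply₂₁, Matrix.fromBlocks_apply₂₂, antiDiag, Matrix.neg_apply,
    Matrix.of_apply, Matrix.zero_apply, mul_zero, Finset.sum_const_zero, zero_add, add_zero, h1]
  simp only [mul_ite, mul_one, mul_zero, mul_neg, Finset.sum_neg_distrib, Finset.sum_ite_eq',
    Finset.mem_univ, if_true, Finset.sum_sub_distrib]
  rw [← Equiv.sum_comp Fin.revPerm (fun x => u (Sum.inl (Fin.rev x)) * v (Sum.inr x))]
  simp [sub_eq_add_neg, Finset.sum_neg_distrib, add_comm]

lemma pairForm_rowEquiv (u v : Fin r × Bool → A) :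
    pairForm u v = ∑ x, (∑ y, u (rowEquiv r y) * sympJ r A y x) * v (rowEquiv r x) := by
  rw [sum_sympJ_mul (fun y => u (rowEquiv r y)) (fun y => v (rowEquiv r y))]
  refine Finset.sum_congr rfl fun i _ => ?_
  simp [rowEquiv]

lemma flagForm_colEquiv (u v : Fin (2 * r) → A) :
    flagForm u v = ∑ x, (∑ y, u (colEquiv r y) * sympJ r A y x) * v (colEquiv r x) := by
  rw [sum_sympJ_mul (fun y => u (colEquiv r y)) (fun y => v (colEquiv r y)), flagForm,
    ← (colEquiv r).sum_comp, Fintype.sum_sum_type, Finset.sum_sub_distrib, sub_eq_add_neg]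
  have hl : ∀ i : Fin r, flagSign A (colEquiv r (Sum.inl i)) = 1 := fun i =>
    if_pos (by simp [colEquiv])
  have hr : ∀ i : Fin r, flagSign A (colEquiv r (Sum.inr i)) = -1 := fun i =>
    if_neg (by simp [colEquiv])
  congr 1
  · exact Finset.sum_congr rfl fun i _ => by rw [hl, rev_colEquiv_inl, one_mul]
  · rw [← Finset.sum_neg_distrib, ← Equiv.sum_comp Fin.revPerm]
    exact Finset.sum_congr rfl fun i _ => by
      rw [Fin.revPerm_apply, hr, rev_colEquiv_inr, Fin.rev_rev]; ring

lemma map_sympJ {B F : Type*} [CommRing B] [FunLike F A B] [RingHomClass F A B] (φ : F) (x y : Fin r ⊕ Fin r) :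
    φ (sympJ r A x y) = sympJ r B x y := by
  rcases x with x | x <;> rcases y with y | y <;> simp [sympJ, antiDiag, apply_ite φ]

lemma isAdmissible_min (r : ℕ) : IsAdmissible r (fun t => min t r) where
  zero := by simp
  step t _ := by omega
  pair k hk := by omega

/-- The rank bounds add nothing at the start: `t + 1` choices among `t` columns repeat one, and `r +
1` isotropic columns have zero minors. -/
lemma schubertSat_of_isotropic {C : Matrix (Fin r × Bool) (Fin (2 * r)) A}
    (h1 : ∀ i i', flagForm (C i) (C i') = 0) (h2 : ∀ k l, pairForm (Cᵀ k) (Cᵀ l) = 0) :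
    SchubertSat 0 0 (fun t => min t r) C := by
  refine schubertSat_iff.2 ⟨h1, h2, fun t ht f g hg => ?_, fun i k h => by omega⟩
  rcases le_or_gt t r with h | h
  · refine det_submatrix_eq_zero_of_le C (fun k => k.val < t) (l := t + 1)
      (by rw [min_eq_left h]) (fun f g hg => ?_) f g hg
    obtain ⟨x, y, hxy, hgxy⟩ := Fintype.exists_ne_map_eq_of_card_lt
      (fun i : Fin (t + 1) => (⟨(g i).val, hg i⟩ : Fin t)) (by simp)
    have : g x = g y := Fin.ext (Fin.mk.inj hgxy)
    exact Matrix.det_zero_of_column_eq hxy fun i => by simp [this]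
  · refine det_submatrix_eq_zero_of_le C (fun _ => True) (l := r + 1)
      (by rw [min_eq_right h.le]) (fun f g _ => ?_) f g (fun _ => trivial)
    exact det_submatrix_eq_zero_of_isotropic (C.submatrix id g) (fun x y => h2 (g x) (g y)) f

variable (k : Type*) [Field k]

lemma isRadical_sympIdeal (r : ℕ) : (sympIdeal k r).IsRadical := by
  let e := (rowEquiv r).prodCongr (colEquiv r)
  let ψ := MvPolynomial.renameEquiv k e
  let I := schubertIdeal k r 0 0 fun t => min t r
  have hI : I.IsRadical := isRadical_schubertIdeal k (Nat.zero_le _) (Nat.zero_le _)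
    (isAdmissible_min r) (by omega)
  obtain ⟨s1, s2, -, -⟩ := schubertSat_iff.1 (schubertSat_quotient k (le_refl I))
  have hle : sympIdeal k r ≤ I.comap ψ := by
    refine sup_le (Ideal.span_le.2 ?_) (Ideal.span_le.2 ?_)
    · rintro _ ⟨⟨x, y⟩, rfl⟩
      have := s1 (rowEquiv r x) (rowEquiv r y)
      rw [flagForm_colEquiv] at this
      rw [SetLike.mem_coe, Ideal.mem_comap, ← Ideal.Quotient.eq_zero_iff_mem, ← this]
      simp only [Matrix.mul_apply, map_sum, map_mul, map_sympJ]
      simp [ψ, e]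
    · rintro _ ⟨⟨x, y⟩, rfl⟩
      have := s2 (colEquiv r x) (colEquiv r y)
      rw [pairForm_rowEquiv] at this
      rw [SetLike.mem_coe, Ideal.mem_comap, ← Ideal.Quotient.eq_zero_iff_mem, ← this]
      simp only [Matrix.mul_apply, map_sum, map_mul, map_sympJ]
      simp [ψ, e]
  let π := Ideal.Quotient.mk (sympIdeal k r)
  have hge : I ≤ RingHom.ker (π.comp (ψ.symm : _ →+* _)) := by
    rw [schubertIdeal_le_ker_iff]
    refine schubertSat_of_isotropic (fun i i' => ?_) (fun x y => ?_)
    · have : π ((genericC k r * sympJ r (MvPolynomial ((Fin r ⊕ Fin r) × (Fin r ⊕ Fin r)) k) * (genericC k r)ᵀ : Matrix _ _ _) ((rowEquiv r).symm i)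
          ((rowEquiv r).symm i')) = 0 := Ideal.Quotient.eq_zero_iff_mem.2
        (Ideal.mem_sup_left (Ideal.subset_span ⟨(_, _), rfl⟩))
      rw [flagForm_colEquiv, ← this]
      simp only [Matrix.mul_apply, map_sum, map_mul, map_sympJ]
      simp [ψ, e, π]
    · have : π (((genericC k r)ᵀ * sympJ r (MvPolynomial ((Fin r ⊕ Fin r) × (Fin r ⊕ Fin r)) k) * genericC k r : Matrix _ _ _) ((colEquiv r).symm x)
          ((colEquiv r).symm y)) = 0 := Ideal.Quotient.eq_zero_iff_mem.2
        (Ideal.mem_sup_right (Ideal.subset_span ⟨(_, _), rfl⟩))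
      rw [pairForm_rowEquiv, ← this]
      simp only [Matrix.mul_apply, map_sum, map_mul, map_sympJ]
      simp [ψ, e, π]
  rintro f ⟨n, hf⟩
  have h1 : ψ f ∈ I := hI ⟨n, by rw [← map_pow]; exact hle hf⟩
  have h2 := hge h1
  rw [RingHom.mem_ker, RingHom.comp_apply] at h2
  simpa using Ideal.Quotient.eq_zero_iff_mem.1 h2

end transfer

theorem mainTheorem2 (k : Type*) [Field k] (r : ℕ) (hr : 1 ≤ r) : IsReduced (SympRing k r) :=
  (Ideal.isRadical_iff_quotient_reduced _).1 (isRadical_sympIdeal k r)
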